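/- Let $\mathbb D$ be the open unit disc of $\mathbb C$. A radial weight is a function $\omega:[0,1)\to(0,\infty)$ such that $z\mapsto\omega(|z|)$ is integrable over $\mathbb D$; put $\widehat\omega(r)=\int_r^1\omega(s)\,ds$ and $\psi_\omega(r)=\widehat\omega(r)/\omega(r)$. A continuous radial weight $\omega$ is called regular if there are constants $c,C>0$ with $c(1-r)\le\psi_\omega(r)\le C(1-r)$ for all $0\le r<1$, and rapidly increasing if $\lim_{r\to1^-}\psi_\omega(r)/(1-r)=\infty$. For $0<p<\infty$ and $f$ analytic in $\mathbb D$ let $M_p(r,f)=\big(\frac1{2\pi}\int_0^{2\pi}|f(re^{i\theta})|^p\,d\theta\big)^{1/p}$ and $\|f\|_{H^p}=\lim_{r\to1^-}M_p(r,f)$. For $0<q<\infty$ and $0<\beta<\infty$, the space $H(p,q,\omega)$, respectively $H(p,\infty,\widehat\omega^\beta)$, consists of the analytic functions $f$ in $\mathbb D$ for which $$\|f\|_{H(p,q,\omega)}=\Big(\int_0^1M_p(r,f)^q\,\omega(r)\,dr\Big)^{1/q},\quad\text{respectively}\quad \|f\|_{H(p,\infty,\widehat\omega^\beta)}=\sup_{0<r<1}M_p(r,f)\,\widehat\omega(r)^\beta,$$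 is finite. Let $1<p<\infty$, $0<\alpha<\infty$, and let $\omega$ be regular or rapidly increasing with $\int_0^1\omega(r)\,dr=1$. For $n=0,1,2,\dots$ let $r_n\in[0,1)$ be the point with $\widehat\omega(r_n)=2^{-n\alpha}$, let $M_n$ be the integer part of $1/(1-r_n)$, and let $I(0)=\{k\ge0:k<M_1\}$ and $I(n)=\{k\ge 1:M_n\le k<M_{n+1}\}$ for $n\ge1$. For $f(z)=\sum_{k\ge0}a_kz^k$ analytic in $\mathbb D$ put $\Delta_n^{\omega,\alpha}f(z)=\sum_{k\in I(n)}a_kz^k$. (i) For every $0<q<\infty$ there is a constant $C>0$, depending only on $p$, $q$, $\alpha$ and $\omega$, such that for every $f$ analytic in $\mathbb D$: $f\in H(p,q,\omega)$ if and only if $\sum_{n=0}^\infty2^{-n\alpha}\|\Delta_n^{\omega,\alpha}f\|_{H^p}^q<\infty$, and $$\frac1C\,\|f\|_{H(p,q,\omega)}\le\Big(\sum_{n=0}^\infty2^{-n\alpha}\|\Delta_n^{\omega,\alpha}f\|_{H^p}^q\Big)^{1/q}\le C\,\|f\|_{H(p,q,\omega)}.$$ (ii) For every $0<\beta<\infty$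 there is a constant $C>0$, depending only on $p$, $\alpha$, $\beta$ and $\omega$, such that for every $f$ analytic in $\mathbb D$: $f\in H(p,\infty,\widehat\omega^\beta)$ if and only if $\sup_n2^{-n\alpha\beta}\|\Delta_n^{\omega,\alpha}f\|_{H^p}<\infty$, and $$\frac1C\,\|f\|_{H(p,\infty,\widehat\omega^\beta)}\le\sup_{n\ge0}2^{-n\alpha\beta}\|\Delta_n^{\omega,\alpha}f\|_{H^p}\le C\,\|f\|_{H(p,\infty,\widehat\omega^\beta)}.$$ (All norms are understood with values in $[0,\infty]$.) -/

import Mathlib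

open MeasureTheory Filter Topology Set

open scoped ENNReal NNReal

noncomputable section

namespace MixedNorm

/-! ### Radial weights

A radial weight is represented by its radial profile `ω`; only the values on `[0,1)` matter. -/

/-- A radial weight: a positive function on `[0,1)` such that `z ↦ ω |z|` is integrable over the
unit disc. -/
structure IsRadialWeight (ω : ℝ → ℝ) : Prop where
  pos : ∀ r ∈ Ico (0 : ℝ) 1, 0 < ω r
  integrable : IntegrableOn (fun z : ℂ => ω ‖z‖) (Metric.ball 0 1)

/-- The tail integral of `ω` from `r` to `1`. -/
def tail (ω : ℝ → ℝ) (r : ℝ) : ℝ := ∫ s in r..1, ω s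

/-- The distortion function of `ω`. -/
def distortion (ω : ℝ → ℝ) (r : ℝ) : ℝ := 1 / ω r * ∫ s in r..1, ω s

/-- Regular weights: continuous radial weights whose distortion function is comparable
to `1 - r`. -/
structure IsRegular (ω : ℝ → ℝ) : Prop where
  weight : IsRadialWeight ω
  continuousOn : ContinuousOn ω (Ico 0 1)
  comparable : ∃ c C : ℝ, 0 < c ∧ 0 < C ∧ ∀ r ∈ Ico (0 : ℝ) 1,
    c * (1 - r) ≤ distortion ω r ∧ distortion ω r ≤ C * (1 - r)

/-- Rapidly increasing weights: continuous radial weights whose distortion function divided by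
`1 - r` tends to infinity at `1`. -/
structure IsRapidlyIncreasing (ω : ℝ → ℝ) : Prop where
  weight : IsRadialWeight ω
  continuousOn : ContinuousOn ω (Ico 0 1)
  tendsto : Tendsto (fun r => distortion ω r / (1 - r)) (𝓝[<] 1) atTop

/-! ### Integral means and norms

All quantities take values in `[0,∞]`, so that each norm is defined for every function. -/

/-- The integral mean of order `p` of `f` over the circle of radius `r`. -/
def integralMean (p : ℝ) (r : ℝ) (f : ℂ → ℂ) : ℝ≥0∞ :=
  (ENNReal.ofReal (1 / (2 * Real.pi)) *
    ∫⁻ θ in Ioc 0 (2 * Real.pi), ‖f (circleMap 0 r θ)‖ₑ ^ p) ^ (1 / p)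

/-- The Hardy space norm, i.e. the limit of the integral means as `r → 1⁻`. For a function that is
analytic in the disc the integral means are nondecreasing in `r`, so that the limit exists
in `[0,∞]` and coincides with the upper limit. -/
def hardyNorm (p : ℝ) (f : ℂ → ℂ) : ℝ≥0∞ :=
  limsup (fun r : ℝ => integralMean p r f) (𝓝[<] 1)

/-- The norm of the mixed norm space `H(p,q,ω)`, `0 < q < ∞`. -/
def mixedNorm (p q : ℝ) (ω : ℝ → ℝ) (f : ℂ → ℂ) : ℝ≥0∞ :=
  (∫⁻ r in Ioo (0 : ℝ) 1, integralMean p r f ^ q * ENNReal.ofReal (ω r)) ^ (1 / q)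

/-- The mixed norm space `H(p,q,ω)`, `0 < q < ∞`. -/
def mixedSpace (p q : ℝ) (ω : ℝ → ℝ) : Set (ℂ → ℂ) :=
  {f | DifferentiableOn ℂ f (Metric.ball 0 1) ∧ mixedNorm p q ω f < ∞}

/-- The norm of the space `H(p,∞,v)` for a radial function `v`. -/
def mixedSupNorm (p : ℝ) (v : ℝ → ℝ) (f : ℂ → ℂ) : ℝ≥0∞ :=
  ⨆ r ∈ Ioo (0 : ℝ) 1, integralMean p r f * ENNReal.ofReal (v r)

/-- The space `H(p,∞,v)` for a radial function `v`. -/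
def mixedSupSpace (p : ℝ) (v : ℝ → ℝ) : Set (ℂ → ℂ) :=
  {f | DifferentiableOn ℂ f (Metric.ball 0 1) ∧ mixedSupNorm p v f < ∞}

/-! ### The Maclaurin blocks -/

/-- The point `r_n` of `[0,1)` at which the tail integral equals `2^{-nα}`; see
`cutRadius_spec` and `cutRadius_unique`. -/
def cutRadius (ω : ℝ → ℝ) (α : ℝ) (n : ℕ) : ℝ :=
  sInf {r : ℝ | r ∈ Ico (0 : ℝ) 1 ∧ tail ω r = (2 : ℝ) ^ (-(n * α))}

/-- The cut-off `M_n`, the integer part of `1 / (1 - r_n)`. -/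
def cutIndex (ω : ℝ → ℝ) (α : ℝ) (n : ℕ) : ℕ := ⌊1 / (1 - cutRadius ω α n)⌋₊

/-- The block of indices `I(n)`; the block `I(0)` starts at `0`. -/
def blockIndices (ω : ℝ → ℝ) (α : ℝ) (n : ℕ) : Finset ℕ :=
  if n = 0 then Finset.range (cutIndex ω α 1)
  else Finset.Ico (cutIndex ω α n) (cutIndex ω α (n + 1))

/-- The `k`-th Maclaurin coefficient. -/
def coeff (f : ℂ → ℂ) (k : ℕ) : ℂ := iteratedDeriv k f 0 / (k.factorial : ℂ)

/-- The polynomial `Δ_n f`. -/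
def block (ω : ℝ → ℝ) (α : ℝ) (n : ℕ) (f : ℂ → ℂ) : ℂ → ℂ :=
  fun z => ∑ k ∈ blockIndices ω α n, coeff f k * z ^ k

/-- The sum of `2^{-nα} ‖Δ_n f‖^q` over `n`. -/
def blockSum (p q : ℝ) (ω : ℝ → ℝ) (α : ℝ) (f : ℂ → ℂ) : ℝ≥0∞ :=
  ∑' n : ℕ, ENNReal.ofReal ((2 : ℝ) ^ (-(n * α))) * hardyNorm p (block ω α n f) ^ q

/-- The supremum of `2^{-nαβ} ‖Δ_n f‖` over `n`. -/
def blockSup (p β : ℝ) (ω : ℝ → ℝ) (α : ℝ) (f : ℂ → ℂ) : ℝ≥0∞ :=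
  ⨆ n : ℕ, ENNReal.ofReal ((2 : ℝ) ^ (-(n * α * β))) * hardyNorm p (block ω α n f)

/-! ### The points `r_n` are well defined -/

theorem tail_strictAntiOn {ω : ℝ → ℝ} (hω : IsRadialWeight ω) (h1 : ∫ r in (0 : ℝ)..1, ω r = 1) :
    StrictAntiOn (tail ω) (Ico 0 1) := by
  have hi : IntervalIntegrable ω volume 0 1 := by
    by_contra h
    rw [intervalIntegral.integral_undef h] at h1
    exact zero_ne_one h1
  intro a ha b hb hab
  have hab' : IntervalIntegrable ω volume a b := hi.mono_set (by
    rw [uIcc_of_le hab.le, uIcc_of_le zero_le_one]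
    exact Icc_subset_Icc ha.1 hb.2.le)
  have hb1 : IntervalIntegrable ω volume b 1 := hi.mono_set (by
    rw [uIcc_of_le hb.2.le, uIcc_of_le zero_le_one]
    exact Icc_subset_Icc hb.1 le_rfl)
  have hsum := intervalIntegral.integral_add_adjacent_intervals hab' hb1
  have hpos : 0 < ∫ s in a..b, ω s :=
    intervalIntegral.intervalIntegral_pos_of_pos_on hab'
      (fun x hx => hω.pos x ⟨ha.1.trans hx.1.le, hx.2.trans hb.2⟩) hab
  unfold tail
  linarith

theorem cutRadius_spec {ω : ℝ → ℝ} (h1 : ∫ r in (0 : ℝ)..1, ω r = 1)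
    {α : ℝ} (hα : 0 < α) (n : ℕ) (hω : IsRadialWeight ω) :
    cutRadius ω α n ∈ Ico (0 : ℝ) 1 ∧ tail ω (cutRadius ω α n) = (2 : ℝ) ^ (-(n * α)) := by
  have hi : IntervalIntegrable ω volume 0 1 := by
    by_contra h
    rw [intervalIntegral.integral_undef h] at h1
    exact zero_ne_one h1
  have hc : ContinuousOn (tail ω) (Icc 0 1) := by
    have := intervalIntegral.continuousOn_primitive_interval_left (a := (0 : ℝ)) (b := 1)
      (f := ω) (μ := volume) (by
        rw [uIcc_of_le zero_le_one]
        exact (intervalIntegrable_iff_integrableOn_Icc_of_le zero_le_one).1 hi)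
    rwa [uIcc_of_le zero_le_one] at this
  have hp : (0 : ℝ) < (2 : ℝ) ^ (-(n * α)) := by positivity
  have hle : (2 : ℝ) ^ (-(n * α)) ≤ 1 :=
    Real.rpow_le_one_of_one_le_of_nonpos one_le_two (by
      have : (0 : ℝ) ≤ n * α := by positivity
      linarith)
  have h0 : tail ω 0 = 1 := h1
  have h1' : tail ω 1 = 0 := by simp [tail]
  obtain ⟨r, hr, hrt⟩ := intermediate_value_Icc' zero_le_one hc
    (show (2 : ℝ) ^ (-(n * α)) ∈ Icc (tail ω 1) (tail ω 0) by
      rw [h0, h1']; exact ⟨hp.le, hle⟩)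
  have hr1 : r < 1 := by
    rcases hr.2.lt_or_eq with h | h
    · exact h
    · rw [h, h1'] at hrt; exact absurd hrt hp.ne
  have hset : {r : ℝ | r ∈ Ico (0 : ℝ) 1 ∧ tail ω r = (2 : ℝ) ^ (-(n * α))} = {r} := by
    ext s
    simp only [mem_ofPred_eq, mem_singleton_iff]
    constructor
    · rintro ⟨hs, hst⟩
      exact (tail_strictAntiOn hω h1).injOn hs ⟨hr.1, hr1⟩ (hst.trans hrt.symm)
    · rintro rfl
      exact ⟨⟨hr.1, hr1⟩, hrt⟩
  rw [cutRadius, hset, csInf_singleton]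
  exact ⟨⟨hr.1, hr1⟩, hrt⟩

theorem cutRadius_unique {ω : ℝ → ℝ} (hω : IsRadialWeight ω)
    (h1 : ∫ r in (0 : ℝ)..1, ω r = 1) {α : ℝ} (hα : 0 < α) (n : ℕ) {r : ℝ}
    (hr : r ∈ Ico (0 : ℝ) 1) (hrt : tail ω r = (2 : ℝ) ^ (-(n * α))) :
    r = cutRadius ω α n :=
  (tail_strictAntiOn hω h1).injOn hr (cutRadius_spec h1 hα n hω).1
    (hrt.trans (cutRadius_spec h1 hα n hω).2.symm)

end MixedNorm

end

/-! Two facts carry the theorem: cutting out a block of Maclaurin coefficients is bounded in `L ^ p`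
of the circle for `1 < p < ∞`, and the radii `r_n` tend to `1` geometrically.

The first fact comes from M. Riesz' conjugate function theorem (`conjugateBound`). It is proved for
`1 < p ≤ 2` by integrating a pointwise inequality on the right half-plane, and for larger `p` by
doubling the exponent. It bounds partial sums (`exists_partialSum_le`). Abel summation then bounds
monotone multipliers, so that for a polynomial `P` with exponents in `[M, N)` one has `r ^ N ‖P‖ ≲
M_p(r, P) ≲ r ^ M ‖P‖` (`exists_integralMean_Ico_le`).

For the second fact, both classes of weights satisfy `ψ_ω(r) ≥ c (1 - r)`. Hence `log ω̂(r) - c⁻¹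
log (1 - r)` is nondecreasing, and `l ^ j (1 - r_{m+j}) ≤ 1 - r_m` for some `l > 1`
(`exists_cutRadius_geometric`). As `M_n` is comparable to `1 / (1 - r_n)`, the power `r ^ M_{n+1}`
is bounded below for `r ≥ r_{n+1}`, while for `r ≤ r_{m+1}` the power `r ^ M_n` is at most `exp (-l
^ (n - m - 1) / 2)` when `n > m`.

The lower power bound gives `‖Δ_n f‖ ≲ M_p(r, f)` for `r ≥ r_{n+1}`, which bounds the block
quantities once it is integrated over `[r_{n+1}, r_{n+2})` or evaluated at `r_{n+1}`. Conversely,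
`M_p(r, f) ≲ ∑ r ^ M_n ‖Δ_n f‖`. On the annulus `[r_m, r_{m+1})` and after normalisation by `ρ ^ m`,
this sum is dominated by the kernel `ρ ^ |m - n|` acting on `ρ ^ n ‖Δ_n f‖`. That kernel is bounded
on `ℓ ^ q` for every `0 < q < ∞` (`exists_tsum_rpow_tsum_le`) and on `ℓ ^ ∞`. The choices are `ρ = 2
^ (-α / q)` and `ρ = 2 ^ (-α β)`. -/

namespace MixedNorm

/-! ### The normalised measure on the circle -/

/-- The uniform probability measure on `(0, 2π]`. -/
noncomputable def circleProb : Measure ℝ :=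
  ENNReal.ofReal (1 / (2 * Real.pi)) • volume.restrict (Ioc 0 (2 * Real.pi))

instance : IsProbabilityMeasure circleProb := by
  constructor
  have h : (0 : ℝ) < 2 * Real.pi := Real.two_pi_pos
  rw [circleProb, Measure.smul_apply, Measure.restrict_apply_univ, Real.volume_Ioc, sub_zero,
    smul_eq_mul, ← ENNReal.ofReal_mul (by positivity), one_div, inv_mul_cancel₀ h.ne',
    ENNReal.ofReal_one]

theorem integral_circleProb {E : Type*} [NormedAddCommGroup E] [NormedSpace ℝ E] (g : ℂ → E)
    (r : ℝ) : ∫ θ, g (circleMap 0 r θ) ∂circleProb = Real.circleAverage g 0 r := by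
  have h : (0 : ℝ) < 2 * Real.pi := Real.two_pi_pos
  rw [circleProb, integral_smul_measure, Real.circleAverage_def,
    intervalIntegral.integral_of_le h.le, ENNReal.toReal_ofReal (by positivity), one_div]

theorem integralMean_eq_eLpNorm {p : ℝ} (hp : 0 < p) (r : ℝ) (f : ℂ → ℂ) :
    integralMean p r f =
      eLpNorm (fun θ => f (circleMap 0 r θ)) (ENNReal.ofReal p) circleProb := by
  rw [eLpNorm_eq_lintegral_rpow_enorm_toReal (by simpa using hp) ENNReal.ofReal_ne_top,
    ENNReal.toReal_ofReal hp.le, circleProb, lintegral_smul_measure, smul_eq_mul, integralMean]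

theorem memLp_circleProb {E : Type*} [NormedAddCommGroup E] {g : ℝ → E} (hg : Continuous g)
    (q : ℝ≥0∞) : MemLp g q circleProb := by
  obtain ⟨C, hC⟩ := isCompact_Icc.exists_bound_of_continuousOn
    (hg.continuousOn (s := Icc 0 (2 * Real.pi)))
  have hm : AEStronglyMeasurable g circleProb := by
    have : AEStronglyMeasurable g (volume.restrict (Ioc 0 (2 * Real.pi))) :=
      hg.continuousOn.aestronglyMeasurable measurableSet_Ioc
    exact this.smul_measure _
  refine MemLp.of_bound hm C ?_
  refine Measure.smul_absolutelyContinuous.ae_le ?_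
  exact (ae_restrict_mem measurableSet_Ioc).mono fun x hx => hC x (Ioc_subset_Icc_self hx)

theorem eLpNorm_circleProb_const {E : Type*} [NormedAddCommGroup E] {p : ℝ} (hp : 0 < p) (c : E) :
    eLpNorm (fun _ : ℝ => c) (ENNReal.ofReal p) circleProb = ‖c‖ₑ := by
  rw [eLpNorm_const c (by simpa using hp) (IsProbabilityMeasure.ne_zero _)]
  simp

/-! ### The conjugate function theorem of M. Riesz -/

/-- On the right half-plane and for `1 < p ≤ 2`, the function `‖z‖ ^ p` is dominated by a
multiple of `(re z) ^ p` up to a harmonic function. -/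
theorem exists_norm_rpow_le {p : ℝ} (hp1 : 1 < p) (hp2 : p ≤ 2) :
    ∃ A B : ℝ, 0 < A ∧ 0 < B ∧ ∀ z : ℂ, 0 < z.re →
      ‖z‖ ^ p ≤ A * z.re ^ p - B * (z ^ (p : ℂ)).re := by
  have hpi := Real.pi_pos
  -- The midpoint of `π / (2p)` and `π / 2`. For `|arg z| ≤ γ` the term with `A` dominates. For
  -- larger angles `p |arg z|` lies between `p γ > π / 2` and `π` (here `p ≤ 2` is needed), so `-B
  -- cos (p arg z) ≥ 1`.
  set γ : ℝ := Real.pi * (1 + p) / (4 * p) with hγ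
  have hpγ : p * γ = Real.pi * (1 + p) / 4 := by rw [hγ]; field_simp
  have hγ0 : 0 < γ := by positivity
  have hγ1 : γ < Real.pi / 2 := by
    rw [hγ, div_lt_div_iff₀ (by positivity) (by positivity)]
    nlinarith
  have hcosγ : 0 < Real.cos γ := Real.cos_pos_of_mem_Ioo ⟨by linarith, hγ1⟩
  have hcos : Real.cos (p * γ) < 0 := by
    rw [hpγ]
    apply Real.cos_neg_of_pi_div_two_lt_of_lt <;> nlinarith
  set B : ℝ := 1 / (-Real.cos (p * γ)) with hB
  have hB0 : 0 < B := by rw [hB]; exact one_div_pos.2 (by linarith)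
  have hB1 : B * Real.cos (p * γ) = -1 := by
    rw [hB, one_div, inv_neg, neg_mul, inv_mul_cancel₀ hcos.ne]
  set A : ℝ := (1 + B) / Real.cos γ ^ p with hA
  have hA0 : 0 < A := by positivity
  have key : ∀ φ : ℝ, |φ| < Real.pi / 2 →
      1 ≤ A * Real.cos φ ^ p - B * Real.cos (φ * p) := by
    intro φ hφ
    have hc : 0 < Real.cos φ := Real.cos_pos_of_mem_Ioo (abs_lt.1 hφ)
    rcases le_or_gt |φ| γ with h | h
    · have h1 : Real.cos γ ≤ Real.cos φ := by
        rw [← Real.cos_abs φ]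
        exact Real.cos_le_cos_of_nonneg_of_le_pi (abs_nonneg _) (by linarith) h
      have h2 : Real.cos γ ^ p ≤ Real.cos φ ^ p :=
        Real.rpow_le_rpow hcosγ.le h1 (by linarith)
      have h3 : A * Real.cos γ ^ p = 1 + B := by
        rw [hA]; field_simp
      nlinarith [Real.cos_le_one (φ * p)]
    · have h1 : Real.cos (φ * p) ≤ Real.cos (p * γ) := by
        rw [← Real.cos_abs (φ * p), abs_mul, abs_of_pos (by linarith : (0 : ℝ) < p), mul_comm]
        apply Real.cos_le_cos_of_nonneg_of_le_pi (by positivity) <;> nlinarith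
      have h2 : 0 ≤ A * Real.cos φ ^ p := by positivity
      nlinarith
  refine ⟨A, B, hA0, hB0, fun z hz => ?_⟩
  have hz0 : z ≠ 0 := by rintro rfl; simp at hz
  have harg : |z.arg| < Real.pi / 2 := Complex.abs_arg_lt_pi_div_two_iff.2 (Or.inl hz)
  have h1 := key _ harg
  have hre : z.re = ‖z‖ * Real.cos z.arg := (Complex.norm_mul_cos_arg z).symm
  have hc : 0 ≤ Real.cos z.arg := (Real.cos_pos_of_mem_Ioo (abs_lt.1 harg)).le
  rw [Complex.cpow_ofReal_re, hre, Real.mul_rpow (norm_nonneg _) hc]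
  have h2 : 0 ≤ ‖z‖ ^ p := by positivity
  nlinarith

/-- A polynomial whose real part is positive on the unit circle has positive real part on the
closed disc. -/
theorem re_eval_pos {H : Polynomial ℂ} (hH : ∀ z : ℂ, ‖z‖ = 1 → 0 < (H.eval z).re) {z : ℂ}
    (hz : ‖z‖ ≤ 1) : 0 < (H.eval z).re := by
  have hcont : ContinuousOn (fun z : ℂ => (H.eval z).re) (Metric.sphere 0 1) := by fun_prop
  obtain ⟨w, hw, hmin⟩ := (isCompact_sphere (0 : ℂ) 1).exists_isMinOn
    (NormedSpace.sphere_nonempty.2 zero_le_one) hcont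
  -- Maximum modulus principle for `exp (-H)`, whose modulus is `exp (-re H)`.
  have hd : DiffContOnCl ℂ (fun z : ℂ => Complex.exp (-H.eval z)) (Metric.ball 0 1) := by
    apply Differentiable.diffContOnCl
    fun_prop
  have := Complex.norm_le_of_forall_mem_frontier_norm_le Metric.isBounded_ball hd
    (C := Real.exp (-(H.eval w).re)) (by
      intro ζ hζ
      rw [frontier_ball _ one_ne_zero] at hζ
      rw [Complex.norm_exp, Complex.neg_re]
      exact Real.exp_le_exp.2 (neg_le_neg (hmin hζ)))
    (z := z) (by rw [closure_ball _ one_ne_zero]; simpa using hz)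
  rw [Complex.norm_exp, Complex.neg_re, Real.exp_le_exp, neg_le_neg_iff] at this
  exact (hH w (by simpa using hw)).trans_le this

theorem norm_circleMap_one (θ : ℝ) : ‖circleMap 0 1 θ‖ = 1 := by simp

theorem continuous_eval_circleMap (F : Polynomial ℂ) (r : ℝ) :
    Continuous fun θ => F.eval (circleMap 0 r θ) := by fun_prop

theorem integral_eval_circleMap (F : Polynomial ℂ) :
    ∫ θ, F.eval (circleMap 0 1 θ) ∂circleProb = F.eval 0 := by
  rw [integral_circleProb (fun z => F.eval z)]
  apply DiffContOnCl.circleAverage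
  apply Differentiable.diffContOnCl
  fun_prop

/-- Integrate the half-plane inequality along `H` on the circle. Since `H` maps the closed disc into
the right half-plane, `H ^ p` is analytic there, and the mean of `re (H ^ p)` is `re (H(0) ^ p) ≥ 0`
because `H(0)` is real and positive. The `B`-term can therefore be dropped. -/
theorem eLpNorm_eval_le_of_re_pos {p : ℝ} (hp1 : 1 < p) (hp2 : p ≤ 2) :
    ∃ A : ℝ≥0, ∀ H : Polynomial ℂ, (∀ z : ℂ, ‖z‖ = 1 → 0 < (H.eval z).re) →
      (H.eval 0).im = 0 →
      eLpNorm (fun θ => H.eval (circleMap 0 1 θ)) (ENNReal.ofReal p) circleProb ≤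
        A * eLpNorm (fun θ => (H.eval (circleMap 0 1 θ)).re) (ENNReal.ofReal p) circleProb := by
  obtain ⟨A, B, hA, hB, hAB⟩ := exists_norm_rpow_le hp1 hp2
  have hp0 : 0 < p := by linarith
  refine ⟨(A ^ (1 / p)).toNNReal, fun H hH h0 => ?_⟩
  have hpos : ∀ θ, 0 < (H.eval (circleMap 0 1 θ)).re := fun θ => hH _ (norm_circleMap_one θ)
  have hc := continuous_eval_circleMap H 1
  have hcre : Continuous fun θ => (H.eval (circleMap 0 1 θ)).re := Complex.continuous_re.comp hc
  have hcp : Continuous fun θ => (H.eval (circleMap 0 1 θ)) ^ (p : ℂ) :=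
    hc.cpow continuous_const fun θ => Or.inl (hpos θ)
  have hmean : ∫ θ, (H.eval (circleMap 0 1 θ)) ^ (p : ℂ) ∂circleProb = (H.eval 0) ^ (p : ℂ) := by
    rw [integral_circleProb (fun z => (H.eval z) ^ (p : ℂ))]
    apply DiffContOnCl.circleAverage
    apply DifferentiableOn.diffContOnCl
    rw [abs_one, closure_ball _ one_ne_zero]
    intro z hz
    have : 0 < (H.eval z).re := re_eval_pos hH (by simpa using hz)
    apply DifferentiableAt.differentiableWithinAt
    exact DifferentiableAt.cpow (by fun_prop) (by fun_prop) (Or.inl this)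
  have hmean0 : 0 ≤ ((H.eval 0) ^ (p : ℂ)).re := by
    have hr : 0 < (H.eval 0).re := re_eval_pos hH (by simp)
    have : H.eval 0 = ((H.eval 0).re : ℂ) := Complex.ext (by simp) (by simpa using h0)
    rw [this, ← Complex.ofReal_cpow hr.le, Complex.ofReal_re]
    positivity
  have i1 : Integrable (fun θ => (H.eval (circleMap 0 1 θ)).re ^ p) circleProb :=
    memLp_one_iff_integrable.1 (memLp_circleProb (hcre.rpow_const fun _ => Or.inr hp0.le) 1)
  have i2 : Integrable (fun θ => ((H.eval (circleMap 0 1 θ)) ^ (p : ℂ))) circleProb :=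
    memLp_one_iff_integrable.1 (memLp_circleProb hcp 1)
  have i2' : Integrable (fun θ => ((H.eval (circleMap 0 1 θ)) ^ (p : ℂ)).re) circleProb := i2.re
  have i3 : Integrable (fun θ => ‖H.eval (circleMap 0 1 θ)‖ ^ p) circleProb :=
    memLp_one_iff_integrable.1 (memLp_circleProb (hc.norm.rpow_const fun _ => Or.inr hp0.le) 1)
  have hle : ∫ θ, ‖H.eval (circleMap 0 1 θ)‖ ^ p ∂circleProb ≤
      A * ∫ θ, (H.eval (circleMap 0 1 θ)).re ^ p ∂circleProb := by
    have hre : ∫ θ, ((H.eval (circleMap 0 1 θ)) ^ (p : ℂ)).re ∂circleProb =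
        ((H.eval 0) ^ (p : ℂ)).re := by
      rw [← hmean]; exact integral_re i2
    calc _ ≤ ∫ θ, (A * (H.eval (circleMap 0 1 θ)).re ^ p -
            B * ((H.eval (circleMap 0 1 θ)) ^ (p : ℂ)).re) ∂circleProb :=
          integral_mono i3 ((i1.const_mul A).sub (i2'.const_mul B)) fun θ => hAB _ (hpos θ)
      _ = A * ∫ θ, (H.eval (circleMap 0 1 θ)).re ^ p ∂circleProb -
            B * ((H.eval 0) ^ (p : ℂ)).re := by
          rw [integral_sub (i1.const_mul A) (i2'.const_mul B), integral_const_mul,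
            integral_const_mul, hre]
      _ ≤ _ := by nlinarith
  have hp' : ENNReal.ofReal p ≠ 0 := by simpa using hp0
  rw [(memLp_circleProb hc _).eLpNorm_eq_integral_rpow_norm hp' ENNReal.ofReal_ne_top,
    (memLp_circleProb hcre _).eLpNorm_eq_integral_rpow_norm hp' ENNReal.ofReal_ne_top,
    ENNReal.toReal_ofReal hp0.le]
  have hnn : ∀ θ, ‖(H.eval (circleMap 0 1 θ)).re‖ = (H.eval (circleMap 0 1 θ)).re := fun θ => by
    rw [Real.norm_eq_abs, abs_of_pos (hpos θ)]
  simp_rw [hnn]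
  rw [← ENNReal.ofReal, ← ENNReal.ofReal_mul (by positivity)]
  apply ENNReal.ofReal_le_ofReal
  have hI : 0 ≤ ∫ θ, (H.eval (circleMap 0 1 θ)).re ^ p ∂circleProb :=
    integral_nonneg fun θ => Real.rpow_nonneg (hpos θ).le _
  rw [one_div, ← Real.mul_rpow hA.le hI]
  exact Real.rpow_le_rpow (integral_nonneg fun θ => by positivity) hle (by positivity)

/-- Real parts of analytic polynomials are dense among the continuous real functions on the
circle. -/
theorem exists_re_eval_near {φ : ℂ → ℝ} (hφ : Continuous φ) {ε : ℝ} (hε : 0 < ε) :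
    ∃ H : Polynomial ℂ, (H.eval 0).im = 0 ∧
      ∀ z : ℂ, ‖z‖ = 1 → |(H.eval z).re - φ z| < ε := by
  have : Fact (0 < 2 * Real.pi) := ⟨Real.two_pi_pos⟩
  let g : C(AddCircle (2 * Real.pi), ℂ) :=
    ⟨fun x => (φ (AddCircle.toCircle x : ℂ) : ℂ), by
      have := AddCircle.continuous_toCircle (T := 2 * Real.pi)
      fun_prop⟩
  -- Taking real parts is not complex linear, so the induction carries an arbitrary factor `a` that
  -- absorbs scalars. A negative frequency is conjugated, `re (a * conj z ^ m) = re (conj a * z ^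
  -- m)`. At frequency zero only `re a` is kept, so that `H(0)` is real.
  have hspan : ∀ f ∈ Submodule.span ℂ (range (fourier (T := 2 * Real.pi))), ∀ a : ℂ,
      ∃ H : Polynomial ℂ, (H.eval 0).im = 0 ∧
        ∀ x, (H.eval (AddCircle.toCircle x : ℂ)).re = (a * f x).re := by
    intro f hf
    induction hf using Submodule.span_induction with
    | mem f hf =>
      obtain ⟨n, rfl⟩ := hf
      intro a
      rcases lt_trichotomy n 0 with hn | rfl | hn
      · obtain ⟨m, rfl⟩ : ∃ m : ℕ, n = -(m : ℤ) := ⟨n.natAbs, by omega⟩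
        refine ⟨Polynomial.C ((starRingEnd ℂ) a) * Polynomial.X ^ m, ?_, fun x => ?_⟩
        · have : m ≠ 0 := by omega
          simp [this]
        · rw [fourier_neg, fourier_apply, ← Complex.conj_re]
          simp [AddCircle.toCircle_nsmul]
      · refine ⟨Polynomial.C (a.re : ℂ), by simp, fun x => by simp⟩
      · obtain ⟨m, rfl⟩ : ∃ m : ℕ, n = (m : ℤ) := ⟨n.natAbs, by omega⟩
        refine ⟨Polynomial.C a * Polynomial.X ^ m, ?_, fun x => ?_⟩
        · have : m ≠ 0 := by omega
          simp [this]
        · rw [fourier_apply]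
          simp [AddCircle.toCircle_nsmul]
    | zero => exact fun a => ⟨0, by simp, by simp⟩
    | add f g _ _ hf hg =>
      intro a
      obtain ⟨F, hF0, hF⟩ := hf a
      obtain ⟨G, hG0, hG⟩ := hg a
      refine ⟨F + G, by simp [hF0, hG0], fun x => ?_⟩
      rw [Polynomial.eval_add, Complex.add_re, hF, hG, ContinuousMap.add_apply, mul_add,
        Complex.add_re]
    | smul c f _ hf =>
      intro a
      obtain ⟨F, hF0, hF⟩ := hf (a * c)
      refine ⟨F, hF0, fun x => ?_⟩
      rw [hF, ContinuousMap.smul_apply, smul_eq_mul, mul_assoc]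
  have hg : g ∈ (Submodule.span ℂ (range (fourier (T := 2 * Real.pi)))).topologicalClosure := by
    rw [span_fourier_closure_eq_top]; trivial
  rw [← SetLike.mem_coe, Submodule.topologicalClosure_coe, Metric.mem_closure_iff] at hg
  obtain ⟨f, hf, hfg⟩ := hg ε hε
  obtain ⟨H, hH0, hH⟩ := hspan f hf 1
  refine ⟨H, hH0, fun z hz => ?_⟩
  have hx : ((AddCircle.toCircle (T := 2 * Real.pi) (z.arg : ℝ)) : ℂ) = z := by
    rw [AddCircle.toCircle_apply_mk, div_self Real.two_pi_pos.ne', one_mul, Circle.coe_exp]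
    simpa [hz] using Complex.norm_mul_exp_arg_mul_I z
  have h1 := hH (z.arg : ℝ)
  rw [hx, one_mul] at h1
  have h2 : (g (z.arg : ℝ)).re = φ z := by
    simp only [g, ContinuousMap.coe_mk, Complex.ofReal_re, hx]
  rw [h1, ← h2, ← Complex.sub_re]
  refine (Complex.abs_re_le_norm _).trans_lt ?_
  rw [← dist_eq_norm, dist_comm]
  exact (ContinuousMap.dist_apply_le_dist _).trans_lt hfg

theorem eLpNorm_circleProb_add_le {E : Type*} [NormedAddCommGroup E] {p : ℝ} (hp : 1 ≤ p)
    {f g : ℝ → E} (hf : Continuous f) (hg : Continuous g) :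
    eLpNorm (fun θ => f θ + g θ) (ENNReal.ofReal p) circleProb ≤
      eLpNorm f (ENNReal.ofReal p) circleProb + eLpNorm g (ENNReal.ofReal p) circleProb :=
  eLpNorm_add_le (memLp_circleProb hf 1).1 (memLp_circleProb hg 1).1
    (ENNReal.one_le_ofReal.2 hp)

theorem eLpNorm_circleProb_sub_le {E : Type*} [NormedAddCommGroup E] {p : ℝ} (hp : 1 ≤ p)
    {f g : ℝ → E} (hf : Continuous f) (hg : Continuous g) :
    eLpNorm (fun θ => f θ - g θ) (ENNReal.ofReal p) circleProb ≤
      eLpNorm f (ENNReal.ofReal p) circleProb + eLpNorm g (ENNReal.ofReal p) circleProb :=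
  eLpNorm_sub_le (memLp_circleProb hf 1).1 (memLp_circleProb hg 1).1
    (ENNReal.one_le_ofReal.2 hp)

/-- The estimate of M. Riesz for the exponent `p`: an analytic polynomial which is real at the
origin is controlled in `L ^ p` by its real part. -/
def ConjugateBound (p : ℝ) : Prop :=
  ∃ A : ℝ≥0, ∀ F : Polynomial ℂ, (F.eval 0).im = 0 →
    eLpNorm (fun θ => F.eval (circleMap 0 1 θ)) (ENNReal.ofReal p) circleProb ≤
      A * eLpNorm (fun θ => (F.eval (circleMap 0 1 θ)).re) (ENNReal.ofReal p) circleProb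

/-- Write `F = H - (H - F)`, where `re H` is uniformly close to the positive part of `re F`. Then
`re H` and `re (H - F)` are approximately the positive and negative parts of `re F`, and the
positive case applies to both. -/
theorem conjugateBound_of_le_two {p : ℝ} (hp1 : 1 < p) (hp2 : p ≤ 2) : ConjugateBound p := by
  obtain ⟨A, hA⟩ := eLpNorm_eval_le_of_re_pos hp1 hp2
  have hp0 : 0 < p := by linarith
  refine ⟨2 * A, fun F hF0 => ?_⟩
  set U := eLpNorm (fun θ => (F.eval (circleMap 0 1 θ)).re) (ENNReal.ofReal p) circleProb with hU
  have hcF := continuous_eval_circleMap F 1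
  have hcre : Continuous fun θ => (F.eval (circleMap 0 1 θ)).re := Complex.continuous_re.comp hcF
  have key : ∀ ε : ℝ, 0 < ε →
      eLpNorm (fun θ => F.eval (circleMap 0 1 θ)) (ENNReal.ofReal p) circleProb ≤
        ((2 * A : ℝ≥0) : ℝ≥0∞) * (U + ENNReal.ofReal (3 * ε)) := by
    intro ε hε
    -- The shift `2 * ε` exceeds the approximation error `ε`: both real parts stay positive and are
    -- at most `|re F| + 3 * ε`.
    obtain ⟨H, hH0, hH⟩ := exists_re_eval_near (φ := fun z => max (F.eval z).re 0 + 2 * ε)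
      (by fun_prop) hε
    have bound : ∀ G : Polynomial ℂ, (G.eval 0).im = 0 →
        (∀ z : ℂ, ‖z‖ = 1 → 0 < (G.eval z).re ∧ (G.eval z).re ≤ |(F.eval z).re| + 3 * ε) →
        eLpNorm (fun θ => G.eval (circleMap 0 1 θ)) (ENNReal.ofReal p) circleProb ≤
          A * (U + ENNReal.ofReal (3 * ε)) := by
      intro G hG0 hG
      refine (hA G (fun z hz => (hG z hz).1) hG0).trans ?_
      gcongr
      calc _ ≤ eLpNorm (fun θ => ‖(F.eval (circleMap 0 1 θ)).re‖ + 3 * ε) (ENNReal.ofReal p)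
              circleProb := by
            refine eLpNorm_mono fun θ => ?_
            have h := hG _ (norm_circleMap_one θ)
            rw [Real.norm_eq_abs, abs_of_pos h.1]
            exact h.2.trans (le_abs_self _)
        _ ≤ eLpNorm (fun θ => ‖(F.eval (circleMap 0 1 θ)).re‖) (ENNReal.ofReal p) circleProb +
              eLpNorm (fun _ : ℝ => 3 * ε) (ENNReal.ofReal p) circleProb :=
            eLpNorm_circleProb_add_le hp1.le hcre.norm continuous_const
        _ = U + ENNReal.ofReal (3 * ε) := by
            rw [eLpNorm_norm, eLpNorm_circleProb_const hp0, Real.enorm_of_nonneg (by positivity)]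
    have b1 := bound H hH0 fun z hz => by
      have h := abs_lt.1 (hH z hz)
      have h1 := le_max_right (F.eval z).re 0
      have h2 : max (F.eval z).re 0 ≤ |(F.eval z).re| := max_le (le_abs_self _) (abs_nonneg _)
      constructor <;> linarith
    have b2 := bound (H - F) (by simp [hH0, hF0]) fun z hz => by
      have h := abs_lt.1 (hH z hz)
      rw [Polynomial.eval_sub, Complex.sub_re]
      have h1 := le_max_left (F.eval z).re 0
      have h2 : max (F.eval z).re 0 ≤ (F.eval z).re + |(F.eval z).re| :=
        max_le (by linarith [abs_nonneg (F.eval z).re]) (by linarith [neg_abs_le (F.eval z).re])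
      constructor <;> linarith
    calc _ = eLpNorm (fun θ => H.eval (circleMap 0 1 θ) - (H - F).eval (circleMap 0 1 θ))
            (ENNReal.ofReal p) circleProb := by simp
      _ ≤ _ := eLpNorm_circleProb_sub_le hp1.le (continuous_eval_circleMap _ _)
            (continuous_eval_circleMap _ _)
      _ ≤ A * (U + ENNReal.ofReal (3 * ε)) + A * (U + ENNReal.ofReal (3 * ε)) := add_le_add b1 b2
      _ = _ := by push_cast; ring
  have hlim : Tendsto (fun ε : ℝ => ((2 * A : ℝ≥0) : ℝ≥0∞) * (U + ENNReal.ofReal (3 * ε)))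
      (𝓝[>] 0) (𝓝 (((2 * A : ℝ≥0) : ℝ≥0∞) * U)) := by
    have h1 : Tendsto (fun ε : ℝ => ENNReal.ofReal (3 * ε)) (𝓝[>] 0) (𝓝 0) := by
      have : Continuous fun ε : ℝ => ENNReal.ofReal (3 * ε) :=
        ENNReal.continuous_ofReal.comp (continuous_const_mul 3)
      simpa using (this.tendsto 0).mono_left nhdsWithin_le_nhds
    have h2 := ENNReal.Tendsto.const_mul (h1.const_add U) (Or.inr ENNReal.coe_ne_top)
      (a := ((2 * A : ℝ≥0) : ℝ≥0∞))
    simpa using h2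
  exact ge_of_tendsto hlim (eventually_mem_nhdsWithin.mono fun ε hε => key ε hε)

/-- By the mean value property the real number `F(0)` is the average of `re F`, and `L ^ 1` norms
are at most `L ^ p` norms for a probability measure. -/
theorem enorm_eval_zero_le {p : ℝ} (hp : 1 ≤ p) {F : Polynomial ℂ} (hF : (F.eval 0).im = 0) :
    ‖F.eval 0‖ₑ ≤
      eLpNorm (fun θ => (F.eval (circleMap 0 1 θ)).re) (ENNReal.ofReal p) circleProb := by
  have hc := continuous_eval_circleMap F 1
  have hcre : Continuous fun θ => (F.eval (circleMap 0 1 θ)).re := Complex.continuous_re.comp hc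
  have h0 : F.eval 0 = ((F.eval 0).re : ℂ) := Complex.ext (by simp) (by simpa using hF)
  have h1 : ∫ θ, (F.eval (circleMap 0 1 θ)).re ∂circleProb = (F.eval 0).re := by
    rw [← integral_eval_circleMap F]
    exact integral_re (memLp_one_iff_integrable.1 (memLp_circleProb hc 1))
  have h2 : ‖((F.eval 0).re : ℂ)‖ₑ = ‖(F.eval 0).re‖ₑ := by
    rw [← ofReal_norm, ← ofReal_norm, Complex.norm_real]
  rw [h0, h2, ← h1]
  refine (enorm_integral_le_lintegral_enorm _).trans ?_
  rw [← eLpNorm_one_eq_lintegral_enorm]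
  exact eLpNorm_le_eLpNorm_of_exponent_le (ENNReal.one_le_ofReal.2 hp) (memLp_circleProb hcre 1).1

/-- Doubling the exponent by applying the estimate to the square. -/
theorem ConjugateBound.two_mul {p : ℝ} (hp : 1 ≤ p) (h : ConjugateBound p) :
    ConjugateBound (2 * p) := by
  obtain ⟨A, hA⟩ := h
  have hp0 : 0 < p := by linarith
  refine ⟨2 * A + 1, fun F hF0 => ?_⟩
  have hcF := continuous_eval_circleMap F 1
  have hcre : Continuous fun θ => (F.eval (circleMap 0 1 θ)).re := Complex.continuous_re.comp hcF
  have hcim : Continuous fun θ => (F.eval (circleMap 0 1 θ)).im := Complex.continuous_im.comp hcF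
  set U := eLpNorm (fun θ => (F.eval (circleMap 0 1 θ)).re) (ENNReal.ofReal (2 * p)) circleProb
    with hU
  set X := eLpNorm (fun θ => F.eval (circleMap 0 1 θ)) (ENNReal.ofReal (2 * p)) circleProb with hX
  have hXtop : X ≠ ∞ := (memLp_circleProb hcF _).2.ne
  have hsq : eLpNorm (fun θ => F.eval (circleMap 0 1 θ) ^ 2) (ENNReal.ofReal p) circleProb =
      X ^ 2 := by
    have h1 := eLpNorm_norm_rpow (μ := circleProb) (p := ENNReal.ofReal p)
      (fun θ => F.eval (circleMap 0 1 θ)) (q := 2) two_pos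
    rw [← ENNReal.ofReal_mul hp0.le, mul_comm p 2, ← hX] at h1
    rw [← ENNReal.rpow_two, ← h1]
    refine eLpNorm_congr_norm_ae (Eventually.of_forall fun θ => ?_)
    simp
  have hF0' : F.eval 0 = ((F.eval 0).re : ℂ) := Complex.ext (by simp) (by simpa using hF0)
  -- The factor `-i` makes `im (F ^ 2) = 2 re F im F` the real part. As `F(0)` is real, the added
  -- constant is purely imaginary: it makes `G(0) = 0` without changing `re G`.
  set G : Polynomial ℂ := Polynomial.C (-Complex.I) * F ^ 2 +
    Polynomial.C (Complex.I * (F.eval 0) ^ 2) with hG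
  have hG0 : G.eval 0 = 0 := by simp [hG]
  have hGre : ∀ z, (G.eval z).re = 2 * ((F.eval z).re * (F.eval z).im) := by
    intro z
    rw [hG, hF0']
    simp [pow_two]
    ring
  have hholder : eLpNorm (fun θ => (G.eval (circleMap 0 1 θ)).re) (ENNReal.ofReal p) circleProb ≤
      2 * (U * X) := by
    have : ENNReal.HolderTriple (ENNReal.ofReal (2 * p)) (ENNReal.ofReal (2 * p)) (ENNReal.ofReal p) := by
      refine ⟨?_⟩
      rw [← ENNReal.ofReal_inv_of_pos (by positivity), ← ENNReal.ofReal_inv_of_pos hp0,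
        ← ENNReal.ofReal_add (by positivity) (by positivity)]
      congr 1
      field_simp
      norm_num
    have h1 := eLpNorm_smul_le_mul_eLpNorm (r := ENNReal.ofReal p)
      (p := ENNReal.ofReal (2 * p)) (q := ENNReal.ofReal (2 * p))
      (memLp_circleProb hcim 1).1 (memLp_circleProb hcre 1).1
    have h2 : eLpNorm (fun θ => (F.eval (circleMap 0 1 θ)).im) (ENNReal.ofReal (2 * p)) circleProb
        ≤ X := eLpNorm_mono fun θ => by
      rw [Real.norm_eq_abs]; exact Complex.abs_im_le_norm _
    have h3 : (fun θ => (G.eval (circleMap 0 1 θ)).re) =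
        (2 : ℝ) • ((fun θ => (F.eval (circleMap 0 1 θ)).re) •
          (fun θ => (F.eval (circleMap 0 1 θ)).im)) := by
      funext θ; simp [hGre]
    rw [h3, eLpNorm_const_smul]
    have h4 : ‖(2 : ℝ)‖ₑ = 2 := by
      rw [Real.enorm_of_nonneg (by norm_num)]; simp
    rw [h4]
    gcongr
    exact h1.trans (by gcongr)
  have hmain : X ^ 2 ≤ A * (2 * (U * X)) + U ^ 2 := by
    calc X ^ 2 = eLpNorm (fun θ => F.eval (circleMap 0 1 θ) ^ 2) (ENNReal.ofReal p)
            circleProb := hsq.symm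
      _ = eLpNorm (fun θ => G.eval (circleMap 0 1 θ) + (-(Complex.I * (F.eval 0) ^ 2)))
            (ENNReal.ofReal p) circleProb := by
          refine eLpNorm_congr_norm_ae (Eventually.of_forall fun θ => ?_)
          simp [hG]
      _ ≤ _ := eLpNorm_circleProb_add_le hp (continuous_eval_circleMap _ _) continuous_const
      _ ≤ A * (2 * (U * X)) + U ^ 2 := by
          gcongr
          · exact (hA G (by simp [hG0])).trans (by gcongr)
          · rw [eLpNorm_circleProb_const hp0, enorm_neg, enorm_mul, enorm_pow]
            have := enorm_eval_zero_le (p := 2 * p) (by linarith) hF0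
            have hI : ‖Complex.I‖ₑ = 1 := by rw [← ofReal_norm]; simp
            rw [hI, one_mul]
            gcongr
  -- The quadratic inequality `hmain` is solved for `X`: if `U < X`, replace `U ^ 2` by `U * X` and
  -- divide by `X`, which is finite.
  rcases le_or_gt X U with hXU | hUX
  · calc X ≤ U := hXU
      _ = 1 * U := (one_mul U).symm
      _ ≤ _ := by gcongr; push_cast; exact le_add_self
  · have hX0 : X ≠ 0 := (pos_of_gt hUX).ne'
    have h1 : X * X ≤ (((2 * A + 1 : ℝ≥0) : ℝ≥0∞) * U) * X := by
      calc X * X = X ^ 2 := (sq X).symm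
        _ ≤ A * (2 * (U * X)) + U ^ 2 := hmain
        _ ≤ A * (2 * (U * X)) + U * X := by rw [sq]; gcongr
        _ = _ := by push_cast; ring
    exact (ENNReal.mul_le_mul_iff_left hX0 hXtop).1 h1

theorem conjugateBound {p : ℝ} (hp : 1 < p) : ConjugateBound p := by
  have key : ∀ k : ℕ, ∀ p : ℝ, 1 < p → p ≤ 2 ^ (k + 1) → ConjugateBound p := by
    intro k
    induction k with
    | zero => exact fun p h1 h2 => conjugateBound_of_le_two h1 (by simpa using h2)
    | succ k ih =>
      intro p h1 h2
      rcases le_or_gt p 2 with h | h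
      · exact conjugateBound_of_le_two h1 h
      · have := (ih (p / 2) (by linarith) (by rw [pow_succ] at h2; linarith)).two_mul
          (by linarith)
        rwa [mul_div_cancel₀ p two_ne_zero] at this
  obtain ⟨k, hk⟩ := pow_unbounded_of_one_lt p one_lt_two
  exact key k p hp (hk.le.trans (pow_le_pow_right₀ one_le_two (Nat.le_succ k)))

/-! ### Partial sums and multipliers -/

/-- The trigonometric polynomials `re (conj z ^ N * g)` and `im (conj z ^ N * g)` are real parts of
analytic polynomials, which together recover the terms of degree at least `N` of `g`. -/
theorem exists_conjugate_pair (a : ℕ → ℂ) (N K : ℕ) :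
    ∃ F G : Polynomial ℂ, (F.eval 0).im = 0 ∧ (G.eval 0).im = 0 ∧ ∀ z : ℂ, ‖z‖ = 1 →
      (F.eval z).re = ((starRingEnd ℂ z) ^ N * ∑ k ∈ Finset.range K, a k * z ^ k).re ∧
      (G.eval z).re = ((starRingEnd ℂ z) ^ N * ∑ k ∈ Finset.range K, a k * z ^ k).im ∧
      z ^ N * (F.eval z + Complex.I * G.eval z + (F.eval 0 + Complex.I * G.eval 0)) =
        2 * ∑ k ∈ Finset.range K, if N ≤ k then a k * z ^ k else 0 := by
  induction K with
  | zero => exact ⟨0, 0, by simp, by simp, fun z _ => by simp⟩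
  | succ K ih =>
    obtain ⟨F, G, hF0, hG0, h⟩ := ih
    -- All the conditions are additive in `F` and `G`, so one monomial at a time is enough.
    suffices ∃ F' G' : Polynomial ℂ, (F'.eval 0).im = 0 ∧ (G'.eval 0).im = 0 ∧ ∀ z : ℂ, ‖z‖ = 1 →
        (F'.eval z).re = ((starRingEnd ℂ z) ^ N * (a K * z ^ K)).re ∧
        (G'.eval z).re = ((starRingEnd ℂ z) ^ N * (a K * z ^ K)).im ∧
        z ^ N * (F'.eval z + Complex.I * G'.eval z + (F'.eval 0 + Complex.I * G'.eval 0)) =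
          2 * if N ≤ K then a K * z ^ K else 0 by
      obtain ⟨F', G', hF0', hG0', h'⟩ := this
      refine ⟨F + F', G + G', by simp [hF0, hF0'], by simp [hG0, hG0'], fun z hz => ?_⟩
      obtain ⟨h1, h2, h3⟩ := h z hz
      obtain ⟨h1', h2', h3'⟩ := h' z hz
      simp only [Polynomial.eval_add, Finset.sum_range_succ, mul_add, Complex.add_re,
        Complex.add_im] at h3 h3' ⊢
      refine ⟨by rw [h1, h1'], by rw [h2, h2'], ?_⟩
      rw [← h3, ← h3']
      ring
    have hzz : ∀ z : ℂ, ‖z‖ = 1 → (starRingEnd ℂ z) * z = 1 := fun z hz => by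
      rw [Complex.conj_mul', hz]; simp
    -- In `F + i G` the frequencies above `N` are doubled, those below `N` cancel, and `N` itself
    -- appears once; adding `F(0) + i G(0)` doubles it too.
    rcases lt_trichotomy N K with hNK | rfl | hNK
    · obtain ⟨m, rfl⟩ := Nat.exists_eq_add_of_lt hNK
      refine ⟨Polynomial.C (a (N + m + 1)) * Polynomial.X ^ (m + 1),
        Polynomial.C (-Complex.I * a (N + m + 1)) * Polynomial.X ^ (m + 1), by simp, by simp,
        fun z hz => ?_⟩
      have e : (starRingEnd ℂ z) ^ N * (a (N + m + 1) * z ^ (N + m + 1)) =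
          a (N + m + 1) * z ^ (m + 1) := by
        calc _ = ((starRingEnd ℂ z) * z) ^ N * (a (N + m + 1) * z ^ (m + 1)) := by ring
          _ = _ := by rw [hzz z hz]; simp
      refine ⟨by rw [e]; simp, by rw [e]; simp [mul_assoc], ?_⟩
      have e2 : Complex.I * (-Complex.I * a (N + m + 1) * z ^ (m + 1)) =
          a (N + m + 1) * z ^ (m + 1) := by
        calc _ = -(Complex.I * Complex.I) * (a (N + m + 1) * z ^ (m + 1)) := by ring
          _ = _ := by simp
      rw [if_pos hNK.le]
      simp only [Polynomial.eval_mul, Polynomial.eval_C, Polynomial.eval_pow, Polynomial.eval_X, e2]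
      simp
      ring
    · refine ⟨Polynomial.C ((a N).re : ℂ), Polynomial.C ((a N).im : ℂ), by simp, by simp,
        fun z hz => ?_⟩
      have e : (starRingEnd ℂ z) ^ N * (a N * z ^ N) = a N := by
        calc _ = ((starRingEnd ℂ z) * z) ^ N * a N := by ring
          _ = _ := by rw [hzz z hz]; simp
      refine ⟨by rw [e]; simp, by rw [e]; simp, ?_⟩
      have e2 : ((a N).re : ℂ) + Complex.I * (a N).im = a N := by
        rw [mul_comm]; exact Complex.re_add_im _
      simp only [Polynomial.eval_C, e2, le_refl, if_true]
      ring
    · obtain ⟨m, rfl⟩ := Nat.exists_eq_add_of_lt hNK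
      refine ⟨Polynomial.C (starRingEnd ℂ (a K)) * Polynomial.X ^ (m + 1),
        Polynomial.C (Complex.I * starRingEnd ℂ (a K)) * Polynomial.X ^ (m + 1), by simp, by simp,
        fun z hz => ?_⟩
      have e : (starRingEnd ℂ z) ^ (K + m + 1) * (a K * z ^ K) =
          starRingEnd ℂ (starRingEnd ℂ (a K) * z ^ (m + 1)) := by
        calc _ = ((starRingEnd ℂ z) * z) ^ K * (a K * (starRingEnd ℂ z) ^ (m + 1)) := by ring
          _ = _ := by rw [hzz z hz]; simp
      refine ⟨by rw [e, Complex.conj_re]; simp, by rw [e, Complex.conj_im]; simp [mul_assoc], ?_⟩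
      have e2 : Complex.I * (Complex.I * starRingEnd ℂ (a K) * z ^ (m + 1)) =
          -(starRingEnd ℂ (a K) * z ^ (m + 1)) := by
        calc _ = (Complex.I * Complex.I) * (starRingEnd ℂ (a K) * z ^ (m + 1)) := by ring
          _ = _ := by simp
      rw [if_neg (by omega)]
      simp only [Polynomial.eval_mul, Polynomial.eval_C, Polynomial.eval_pow, Polynomial.eval_X, e2]
      simp

/-- Partial sums of power series are uniformly bounded in `L ^ p` of the circle. -/
theorem exists_partialSum_le {p : ℝ} (hp : 1 < p) :
    ∃ A : ℝ≥0, ∀ (a : ℕ → ℂ) (N K : ℕ), N ≤ K →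
      eLpNorm (fun θ => ∑ k ∈ Finset.range N, a k * circleMap 0 1 θ ^ k) (ENNReal.ofReal p)
        circleProb ≤
      A * eLpNorm (fun θ => ∑ k ∈ Finset.range K, a k * circleMap 0 1 θ ^ k) (ENNReal.ofReal p)
        circleProb := by
  obtain ⟨A, hA⟩ := conjugateBound hp
  have hp0 : 0 < p := by linarith
  -- The sum up to `K` costs `1`. The removed tail costs `A` for each of `F` and `G` and `1` for
  -- each of their values at `0`; the gain of a factor `1 / 2` in the tail is discarded.
  refine ⟨1 + (A + A + (1 + 1)), fun a N K hNK => ?_⟩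
  have hsum : ∀ s : Finset ℕ, Continuous fun θ => ∑ k ∈ s, a k * circleMap 0 1 θ ^ k :=
    fun s => by fun_prop
  set S := eLpNorm (fun θ => ∑ k ∈ Finset.range K, a k * circleMap 0 1 θ ^ k) (ENNReal.ofReal p)
    circleProb with hS
  obtain ⟨F, G, hF0, hG0, h⟩ := exists_conjugate_pair a N K
  have hFre : eLpNorm (fun θ => (F.eval (circleMap 0 1 θ)).re) (ENNReal.ofReal p) circleProb ≤ S :=
    eLpNorm_mono fun θ => by
      rw [(h _ (norm_circleMap_one θ)).1, Real.norm_eq_abs]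
      refine (Complex.abs_re_le_norm _).trans ?_
      simp
  have hGre : eLpNorm (fun θ => (G.eval (circleMap 0 1 θ)).re) (ENNReal.ofReal p) circleProb ≤ S :=
    eLpNorm_mono fun θ => by
      rw [(h _ (norm_circleMap_one θ)).2.1, Real.norm_eq_abs]
      refine (Complex.abs_im_le_norm _).trans ?_
      simp
  have hI : ‖Complex.I‖ₑ = 1 := by rw [← ofReal_norm]; simp
  have hcG : Continuous fun θ => Complex.I * G.eval (circleMap 0 1 θ) :=
    continuous_const.mul (continuous_eval_circleMap G 1)
  have htail : eLpNorm (fun θ => ∑ k ∈ Finset.Ico N K, a k * circleMap 0 1 θ ^ k)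
      (ENNReal.ofReal p) circleProb ≤ (A * S + A * S) + (S + S) := by
    calc _ ≤ eLpNorm (fun θ => F.eval (circleMap 0 1 θ) + Complex.I * G.eval (circleMap 0 1 θ) +
              (F.eval 0 + Complex.I * G.eval 0)) (ENNReal.ofReal p) circleProb := by
          refine eLpNorm_mono fun θ => ?_
          have h3 := (h _ (norm_circleMap_one θ)).2.2
          have h4 : (∑ k ∈ Finset.range K, if N ≤ k then a k * circleMap 0 1 θ ^ k else 0) =
              ∑ k ∈ Finset.Ico N K, a k * circleMap 0 1 θ ^ k := by
            rw [← Finset.sum_filter]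
            congr 1
            ext k
            simp [and_comm]
          have h5 := congrArg norm h3
          rw [h4, norm_mul, norm_pow, norm_circleMap_one, one_pow, one_mul, norm_mul] at h5
          rw [h5]
          simp only [Complex.norm_ofNat]
          linarith [norm_nonneg (∑ k ∈ Finset.Ico N K, a k * circleMap 0 1 θ ^ k)]
      _ ≤ _ := eLpNorm_circleProb_add_le hp.le ((continuous_eval_circleMap F 1).add hcG)
            continuous_const
      _ ≤ _ := by
          gcongr
          · refine (eLpNorm_circleProb_add_le hp.le (continuous_eval_circleMap F 1) hcG).trans ?_
            gcongr
            · exact (hA F hF0).trans (by gcongr)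
            · have : eLpNorm (fun θ => Complex.I * G.eval (circleMap 0 1 θ)) (ENNReal.ofReal p)
                  circleProb = eLpNorm (fun θ => G.eval (circleMap 0 1 θ)) (ENNReal.ofReal p)
                  circleProb :=
                eLpNorm_congr_norm_ae (Eventually.of_forall fun θ => by simp)
              rw [this]
              exact (hA G hG0).trans (by gcongr)
          · rw [eLpNorm_circleProb_const hp0]
            refine (enorm_add_le _ _).trans ?_
            rw [enorm_mul, hI, one_mul]
            exact add_le_add ((enorm_eval_zero_le hp.le hF0).trans hFre)
              ((enorm_eval_zero_le hp.le hG0).trans hGre)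
  calc _ = eLpNorm (fun θ => ∑ k ∈ Finset.range K, a k * circleMap 0 1 θ ^ k -
          ∑ k ∈ Finset.Ico N K, a k * circleMap 0 1 θ ^ k) (ENNReal.ofReal p) circleProb := by
        congr 1
        funext θ
        rw [eq_sub_iff_add_eq, Finset.sum_range_add_sum_Ico _ hNK]
    _ ≤ _ := eLpNorm_circleProb_sub_le hp.le (hsum _) (hsum _)
    _ ≤ S + ((A * S + A * S) + (S + S)) := by gcongr
    _ = _ := by push_cast; ring

theorem circleMap_zero_eq_mul (r θ : ℝ) : circleMap 0 r θ = r * circleMap 0 1 θ := by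
  simp [circleMap]

/-- Bounded monotone multipliers act boundedly in `L ^ p` of the circle. -/
theorem exists_multiplier_le {p : ℝ} (hp : 1 < p) :
    ∃ A : ℝ≥0, ∀ (a : ℕ → ℂ) (l : ℕ → ℝ) (L : ℝ) (K : ℕ), (Monotone l ∨ Antitone l) →
      (∀ k, 0 ≤ l k) → (∀ k, l k ≤ L) →
      eLpNorm (fun θ => ∑ k ∈ Finset.range K, (l k : ℂ) * (a k * circleMap 0 1 θ ^ k))
        (ENNReal.ofReal p) circleProb ≤
      A * ENNReal.ofReal L * eLpNorm (fun θ => ∑ k ∈ Finset.range K, a k * circleMap 0 1 θ ^ k)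
        (ENNReal.ofReal p) circleProb := by
  obtain ⟨A, hA⟩ := exists_partialSum_le hp
  refine ⟨2 * A, fun a l L K hmono h0 hL => ?_⟩
  set S := eLpNorm (fun θ => ∑ k ∈ Finset.range K, a k * circleMap 0 1 θ ^ k) (ENNReal.ofReal p)
    circleProb with hS
  set G : ℕ → ℝ → ℂ := fun N θ => ∑ k ∈ Finset.range N, a k * circleMap 0 1 θ ^ k with hG
  have hGc : ∀ N, Continuous (G N) := fun N => by fun_prop
  have hsmul : ∀ (c : ℝ) (N : ℕ), N ≤ K →
      eLpNorm (fun θ => (c : ℂ) * G N θ) (ENNReal.ofReal p) circleProb ≤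
        ENNReal.ofReal |c| * (A * S) := by
    intro c N hN
    have h1 : (fun θ => (c : ℂ) * G N θ) = (c : ℂ) • G N := by funext θ; simp
    have h2 : ‖(c : ℂ)‖ₑ = ENNReal.ofReal |c| := by rw [← ofReal_norm, Complex.norm_real]; rfl
    rw [h1, eLpNorm_const_smul, h2]
    gcongr
    exact hA a N K hN
  -- A monotone sequence in `[0, L]` has total variation at most `L`. After Abel summation this
  -- bounds the difference terms, and the boundary term costs another `L`, hence `2 * A`.
  have hvar : ∑ i ∈ Finset.range (K - 1), |l (i + 1) - l i| ≤ L := by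
    rcases hmono with hm | hm
    · have : ∀ i ∈ Finset.range (K - 1), |l (i + 1) - l i| = l (i + 1) - l i := fun i _ =>
        abs_of_nonneg (sub_nonneg.2 (hm (Nat.le_succ i)))
      rw [Finset.sum_congr rfl this, Finset.sum_range_sub]
      linarith [hL (K - 1), h0 0]
    · have : ∀ i ∈ Finset.range (K - 1), |l (i + 1) - l i| = l i - l (i + 1) := fun i _ => by
        rw [abs_of_nonpos (sub_nonpos.2 (hm (Nat.le_succ i))), neg_sub]
      rw [Finset.sum_congr rfl this, Finset.sum_range_sub']
      linarith [hL 0, h0 (K - 1)]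
  calc _ = eLpNorm (fun θ => (l (K - 1) : ℂ) * G K θ -
          ∑ i ∈ Finset.range (K - 1), ((l (i + 1) - l i : ℝ) : ℂ) * G (i + 1) θ)
          (ENNReal.ofReal p) circleProb := by
        congr 1
        funext θ
        have := Finset.sum_range_by_parts (fun k => (l k : ℂ)) (fun k => a k * circleMap 0 1 θ ^ k) K
        simpa only [smul_eq_mul, Complex.ofReal_sub] using this
    _ ≤ _ := eLpNorm_circleProb_sub_le hp.le (by fun_prop) (by fun_prop)
    _ ≤ ENNReal.ofReal L * (A * S) + ENNReal.ofReal L * (A * S) := by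
        gcongr
        · refine (hsmul _ K le_rfl).trans ?_
          gcongr
          rw [abs_of_nonneg (h0 _)]
          exact hL _
        · have hfun : (fun θ => ∑ i ∈ Finset.range (K - 1),
              ((l (i + 1) - l i : ℝ) : ℂ) * G (i + 1) θ) =
              ∑ i ∈ Finset.range (K - 1), fun θ => ((l (i + 1) - l i : ℝ) : ℂ) * G (i + 1) θ := by
            funext θ; simp
          rw [hfun]
          refine (eLpNorm_sum_le (fun i _ => (memLp_circleProb (by fun_prop) 1).1)
            (ENNReal.one_le_ofReal.2 hp.le)).trans ?_
          refine (Finset.sum_le_sum fun i hi => hsmul _ (i + 1) ?_).trans ?_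
          · have := Finset.mem_range.1 hi; omega
          · rw [← Finset.sum_mul, ← ENNReal.ofReal_sum_of_nonneg fun i _ => abs_nonneg _]
            gcongr
    _ = _ := by push_cast; ring

/-- The two-sided comparison of the integral means of a polynomial with exponents in `[M, N)` on
the circles of radii `r` and `1`. -/
theorem exists_integralMean_Ico_le {p : ℝ} (hp : 1 < p) :
    ∃ A : ℝ≥0, ∀ (a : ℕ → ℂ) (M N : ℕ) (r : ℝ), 0 ≤ r → r ≤ 1 →
      integralMean p r (fun z => ∑ k ∈ Finset.Ico M N, a k * z ^ k) ≤
        A * ENNReal.ofReal (r ^ M) *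
          integralMean p 1 (fun z => ∑ k ∈ Finset.Ico M N, a k * z ^ k) ∧
      ENNReal.ofReal (r ^ N) * integralMean p 1 (fun z => ∑ k ∈ Finset.Ico M N, a k * z ^ k) ≤
        A * integralMean p r (fun z => ∑ k ∈ Finset.Ico M N, a k * z ^ k) := by
  obtain ⟨A, hA⟩ := exists_multiplier_le hp
  have hp0 : 0 < p := by linarith
  refine ⟨A, fun a M N r hr0 hr1 => ?_⟩
  have hIco : ∀ b : ℕ → ℂ, ∑ k ∈ Finset.range N, (if M ≤ k then b k else 0) =
      ∑ k ∈ Finset.Ico M N, b k := by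
    intro b
    rw [← Finset.sum_filter]
    congr 1
    ext k
    simp [and_comm]
  rw [integralMean_eq_eLpNorm hp0, integralMean_eq_eLpNorm hp0]
  constructor
  -- The multiplier `r ^ max k M` agrees with `r ^ k` on the block and is at most `r ^ M` for every
  -- index.
  · have h := hA (fun k => if M ≤ k then a k else 0) (fun k => r ^ max k M) (r ^ M) N
      (Or.inr fun i j hij => pow_le_pow_of_le_one hr0 hr1 (max_le_max_right M hij))
      (fun k => by positivity) (fun k => pow_le_pow_of_le_one hr0 hr1 (le_max_right _ _))
    convert h using 2
    · funext θ
      rw [← hIco]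
      refine Finset.sum_congr rfl fun k _ => ?_
      split_ifs with hk
      · rw [circleMap_zero_eq_mul r, max_eq_left hk, mul_pow]
        push_cast
        ring
      · simp
    · congr 1
      funext θ
      rw [← hIco]
      refine Finset.sum_congr rfl fun k _ => ?_
      split_ifs <;> simp
  -- Here `r ^ N = r ^ (N - k) * r ^ k`. With truncated subtraction the multiplier `r ^ (N - k)` is
  -- nondecreasing in `k` and at most `1` for all `k`.
  · have h := hA (fun k => if M ≤ k then (r : ℂ) ^ k * a k else 0) (fun k => r ^ (N - k)) 1 N
      (Or.inl fun i j hij => pow_le_pow_of_le_one hr0 hr1 (by omega))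
      (fun k => by positivity) (fun k => pow_le_one₀ hr0 hr1)
    rw [ENNReal.ofReal_one, mul_one] at h
    have h2 : ‖((r ^ N : ℝ) : ℂ)‖ₑ = ENNReal.ofReal (r ^ N) := by
      rw [← ofReal_norm, Complex.norm_real, Real.norm_of_nonneg (by positivity)]
    rw [← h2, ← eLpNorm_const_smul]
    convert h using 2
    · funext θ
      rw [Pi.smul_apply, smul_eq_mul, ← hIco, Finset.mul_sum]
      refine Finset.sum_congr rfl fun k hk => ?_
      have hkN := Finset.mem_range.1 hk
      split_ifs with hk
      · have : (r : ℂ) ^ N = (r : ℂ) ^ (N - k) * (r : ℂ) ^ k := by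
          rw [← pow_add]; congr 1; omega
        push_cast
        rw [this]
        ring
      · simp
    · congr 1
      funext θ
      rw [← hIco]
      refine Finset.sum_congr rfl fun k _ => ?_
      split_ifs
      · rw [circleMap_zero_eq_mul r, mul_pow]
        ring
      · simp

theorem eLpNorm_circleProb_le_of_norm_sub_le {p : ℝ} (hp : 1 ≤ p) {f g : ℝ → ℂ}
    (hf : Continuous f) (hg : Continuous g) {δ : ℝ} (h : ∀ θ, ‖f θ - g θ‖ ≤ δ) :
    eLpNorm f (ENNReal.ofReal p) circleProb ≤
      eLpNorm g (ENNReal.ofReal p) circleProb + ENNReal.ofReal δ := by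
  have hδ : 0 ≤ δ := (norm_nonneg _).trans (h 0)
  calc _ = eLpNorm (fun θ => g θ + (f θ - g θ)) (ENNReal.ofReal p) circleProb := by simp
    _ ≤ _ := eLpNorm_circleProb_add_le hp hg (hf.sub hg)
    _ ≤ _ := by
      gcongr
      calc _ ≤ eLpNorm (fun _ : ℝ => δ) (ENNReal.ofReal p) circleProb :=
            eLpNorm_mono fun θ => (h θ).trans (le_abs_self δ)
        _ = _ := by rw [eLpNorm_circleProb_const (by linarith), Real.enorm_of_nonneg hδ]

/-- The dilates of a polynomial converge uniformly on the circle as `r → 1`, so the upper limit is a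
limit. -/
theorem hardyNorm_polynomial {p : ℝ} (hp : 1 ≤ p) (a : ℕ → ℂ) (s : Finset ℕ) :
    hardyNorm p (fun z => ∑ k ∈ s, a k * z ^ k) =
      integralMean p 1 (fun z => ∑ k ∈ s, a k * z ^ k) := by
  have hp0 : 0 < p := by linarith
  refine Tendsto.limsup_eq ?_
  simp_rw [integralMean_eq_eLpNorm hp0]
  set δ : ℝ → ℝ := fun r => ∑ k ∈ s, ‖a k‖ * |r ^ k - 1| with hδ
  have hδc : Continuous δ := by fun_prop
  have hδ1 : δ 1 = 0 := by simp [hδ]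
  have hδt : Tendsto (fun r => ENNReal.ofReal (δ r)) (𝓝[<] 1) (𝓝 0) := by
    have := ((ENNReal.continuous_ofReal.comp hδc).tendsto 1).mono_left
      (nhdsWithin_le_nhds (s := Iio 1))
    simpa [hδ1, Function.comp_def] using this
  have hclose : ∀ r θ : ℝ, ‖(∑ k ∈ s, a k * circleMap 0 r θ ^ k) -
      ∑ k ∈ s, a k * circleMap 0 1 θ ^ k‖ ≤ δ r := by
    intro r θ
    rw [← Finset.sum_sub_distrib]
    refine (norm_sum_le _ _).trans (Finset.sum_le_sum fun k _ => ?_)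
    have : a k * circleMap 0 r θ ^ k - a k * circleMap 0 1 θ ^ k =
        a k * (((r ^ k - 1 : ℝ) : ℂ) * circleMap 0 1 θ ^ k) := by
      rw [circleMap_zero_eq_mul r, mul_pow]; push_cast; ring
    rw [this, norm_mul, norm_mul, norm_pow, norm_circleMap_one, one_pow, mul_one,
      Complex.norm_real, Real.norm_eq_abs]
  have hc : ∀ r : ℝ, Continuous fun θ => ∑ k ∈ s, a k * circleMap 0 r θ ^ k :=
    fun r => by fun_prop
  refine tendsto_of_tendsto_of_tendsto_of_le_of_le
    (g := fun r => eLpNorm (fun θ => ∑ k ∈ s, a k * circleMap 0 1 θ ^ k) (ENNReal.ofReal p)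
      circleProb - ENNReal.ofReal (δ r))
    (h := fun r => eLpNorm (fun θ => ∑ k ∈ s, a k * circleMap 0 1 θ ^ k) (ENNReal.ofReal p)
      circleProb + ENNReal.ofReal (δ r)) ?_ ?_ ?_ ?_
  · have := ENNReal.Tendsto.sub (tendsto_const_nhds (x := eLpNorm (fun θ =>
      ∑ k ∈ s, a k * circleMap 0 1 θ ^ k) (ENNReal.ofReal p) circleProb)) hδt
      (Or.inl (memLp_circleProb (hc 1) _).2.ne)
    simpa using this
  · simpa using hδt.const_add (eLpNorm (fun θ =>
      ∑ k ∈ s, a k * circleMap 0 1 θ ^ k) (ENNReal.ofReal p) circleProb)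
  · intro r
    rw [tsub_le_iff_right]
    exact eLpNorm_circleProb_le_of_norm_sub_le hp (hc 1) (hc r) fun θ => by
      rw [norm_sub_rev]; exact hclose r θ
  · intro r
    exact eLpNorm_circleProb_le_of_norm_sub_le hp (hc r) (hc 1) (hclose r)

/-! ### Maclaurin series -/

theorem hasSum_coeff {f : ℂ → ℂ} (hf : DifferentiableOn ℂ f (Metric.ball 0 1)) {z : ℂ}
    (hz : ‖z‖ < 1) : HasSum (fun k => coeff f k * z ^ k) (f z) := by
  have := Complex.hasSum_taylorSeries_on_ball hf (z := z) (by simpa using hz)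
  have h : (fun k => coeff f k * z ^ k) =
      fun k => ((k.factorial : ℂ))⁻¹ • (z - 0) ^ k • iteratedDeriv k f 0 := by
    funext k
    simp only [coeff, smul_eq_mul, sub_zero]
    ring
  rw [h]
  exact this

/-- The Maclaurin series converges uniformly on every circle inside the disc. -/
theorem exists_norm_sub_partialSum_le {f : ℂ → ℂ} (hf : DifferentiableOn ℂ f (Metric.ball 0 1))
    {r : ℝ} (hr0 : 0 ≤ r) (hr1 : r < 1) :
    ∃ δ : ℕ → ℝ, Tendsto δ atTop (𝓝 0) ∧ ∀ (K : ℕ) (z : ℂ), ‖z‖ = r →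
      ‖f z - ∑ k ∈ Finset.range K, coeff f k * z ^ k‖ ≤ δ K := by
  have hs : Summable fun k => ‖coeff f k‖ * r ^ k := by
    have := (hasSum_coeff hf (z := (r : ℂ)) (by simpa [abs_of_nonneg hr0] using hr1)).summable.norm
    simpa [abs_of_nonneg hr0] using this
  refine ⟨fun K => ∑' k, ‖coeff f (k + K)‖ * r ^ (k + K),
    tendsto_sum_nat_add fun k => ‖coeff f k‖ * r ^ k, fun K z hz => ?_⟩
  have hS := hasSum_coeff hf (hz.trans_lt hr1)
  rw [← hS.tsum_eq, ← hS.summable.sum_add_tsum_nat_add K, add_sub_cancel_left]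
  have hnorm : ∀ k, ‖coeff f (k + K) * z ^ (k + K)‖ = ‖coeff f (k + K)‖ * r ^ (k + K) := fun k => by
    rw [norm_mul, norm_pow, hz]
  have hs' := (summable_nat_add_iff K).2 hs
  refine (norm_tsum_le_tsum_norm (hs'.congr fun k => (hnorm k).symm)).trans (le_of_eq ?_)
  exact tsum_congr hnorm

theorem continuous_comp_circleMap {f : ℂ → ℂ} (hf : DifferentiableOn ℂ f (Metric.ball 0 1))
    {r : ℝ} (hr0 : 0 ≤ r) (hr1 : r < 1) : Continuous fun θ => f (circleMap 0 r θ) :=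
  hf.continuousOn.comp_continuous (continuous_circleMap 0 r) fun θ => by
    simpa [abs_of_nonneg hr0] using hr1

/-- Blocks of the Maclaurin series are uniformly bounded with respect to the integral means. -/
theorem exists_integralMean_Ico_coeff_le {p : ℝ} (hp : 1 < p) :
    ∃ A : ℝ≥0, ∀ (f : ℂ → ℂ), DifferentiableOn ℂ f (Metric.ball 0 1) → ∀ (M N : ℕ) (r : ℝ),
      0 ≤ r → r < 1 →
      integralMean p r (fun z => ∑ k ∈ Finset.Ico M N, coeff f k * z ^ k) ≤
        A * integralMean p r f := by
  obtain ⟨A, hA⟩ := exists_partialSum_le hp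
  have hp0 : 0 < p := by linarith
  refine ⟨A + A, fun f hf M N r hr0 hr1 => ?_⟩
  simp_rw [integralMean_eq_eLpNorm hp0]
  obtain ⟨δ, hδ, hclose⟩ := exists_norm_sub_partialSum_le hf hr0 hr1
  have hc : ∀ s : Finset ℕ, Continuous fun θ => ∑ k ∈ s, coeff f k * circleMap 0 r θ ^ k :=
    fun s => by fun_prop
  have hcf := continuous_comp_circleMap hf hr0 hr1
  set S := eLpNorm (fun θ => f (circleMap 0 r θ)) (ENNReal.ofReal p) circleProb with hS
  -- Moving `r ^ k` into the coefficients reduces to the unit circle, with a constant independent of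
  -- `r`. The bound for polynomials reaches `f` by letting the length `K` of the longer partial sum
  -- tend to infinity.
  have hdil : ∀ N : ℕ, (fun θ => ∑ k ∈ Finset.range N, coeff f k * circleMap 0 r θ ^ k) =
      fun θ => ∑ k ∈ Finset.range N, (coeff f k * (r : ℂ) ^ k) * circleMap 0 1 θ ^ k := by
    intro N
    funext θ
    refine Finset.sum_congr rfl fun k _ => ?_
    rw [circleMap_zero_eq_mul r, mul_pow]
    ring
  have hpart : ∀ N : ℕ, eLpNorm (fun θ => ∑ k ∈ Finset.range N, coeff f k * circleMap 0 r θ ^ k)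
      (ENNReal.ofReal p) circleProb ≤ A * S := by
    intro N
    have hlim : Tendsto (fun K => (A : ℝ≥0∞) * (S + ENNReal.ofReal (δ K))) atTop
        (𝓝 ((A : ℝ≥0∞) * S)) := by
      have h1 : Tendsto (fun K => ENNReal.ofReal (δ K)) atTop (𝓝 0) := by
        simpa using ENNReal.tendsto_ofReal hδ
      simpa using ENNReal.Tendsto.const_mul (h1.const_add S) (Or.inr ENNReal.coe_ne_top)
        (a := (A : ℝ≥0∞))
    refine ge_of_tendsto hlim ((eventually_ge_atTop N).mono fun K hK => ?_)
    have h1 := hA (fun k => coeff f k * (r : ℂ) ^ k) N K hK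
    rw [← hdil, ← hdil] at h1
    refine h1.trans ?_
    gcongr
    exact eLpNorm_circleProb_le_of_norm_sub_le hp.le (hc _) hcf fun θ => by
      rw [norm_sub_rev]
      exact hclose K _ (by simp [abs_of_nonneg hr0])
  rcases le_or_gt M N with hMN | hMN
  · calc _ = eLpNorm (fun θ => ∑ k ∈ Finset.range N, coeff f k * circleMap 0 r θ ^ k -
          ∑ k ∈ Finset.range M, coeff f k * circleMap 0 r θ ^ k) (ENNReal.ofReal p)
          circleProb := by
          congr 1
          funext θ
          rw [← Finset.sum_range_add_sum_Ico _ hMN, add_sub_cancel_left]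
      _ ≤ _ := eLpNorm_circleProb_sub_le hp.le (hc _) (hc _)
      _ ≤ A * S + A * S := add_le_add (hpart N) (hpart M)
      _ = _ := by push_cast; ring
  · rw [Finset.Ico_eq_empty (by omega)]
    simp

/-! ### Norm estimates for the blocks -/

/-- The first index of the block `n`. -/
noncomputable def blockStart (ω : ℝ → ℝ) (α : ℝ) (n : ℕ) : ℕ := if n = 0 then 0 else cutIndex ω α n

theorem blockIndices_eq_Ico (ω : ℝ → ℝ) (α : ℝ) (n : ℕ) :
    blockIndices ω α n = Finset.Ico (blockStart ω α n) (cutIndex ω α (n + 1)) := by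
  unfold blockIndices blockStart
  split_ifs with h
  · subst h; simp
  · rfl

theorem sum_block {ω : ℝ → ℝ} {α : ℝ} (hM : Monotone (cutIndex ω α)) (f : ℂ → ℂ) (z : ℂ) (m : ℕ) :
    ∑ n ∈ Finset.range (m + 1), block ω α n f z =
      ∑ k ∈ Finset.range (cutIndex ω α (m + 1)), coeff f k * z ^ k := by
  induction m with
  | zero => simp [block, blockIndices]
  | succ m ih =>
    rw [Finset.sum_range_succ, ih, block, blockIndices, if_neg (Nat.succ_ne_zero m)]
    exact Finset.sum_range_add_sum_Ico _ (hM (Nat.le_succ _))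

/-- Minkowski's inequality over the blocks, each costing `r` to the power of its lowest exponent.
Partial sums made of whole blocks converge to `f` on the circle because the cut indices tend to
infinity. -/
theorem exists_integralMean_le_tsum {p : ℝ} (hp : 1 < p) :
    ∃ A : ℝ≥0, ∀ (ω : ℝ → ℝ) (α : ℝ), Monotone (cutIndex ω α) →
      Tendsto (cutIndex ω α) atTop atTop → ∀ f : ℂ → ℂ,
      DifferentiableOn ℂ f (Metric.ball 0 1) → ∀ r : ℝ, 0 ≤ r → r < 1 →
      integralMean p r f ≤
        A * ∑' n, ENNReal.ofReal (r ^ blockStart ω α n) * hardyNorm p (block ω α n f) := by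
  obtain ⟨A, hA⟩ := exists_integralMean_Ico_le hp
  have hp0 : 0 < p := by linarith
  refine ⟨A, fun ω α hM hMt f hf r hr0 hr1 => ?_⟩
  obtain ⟨δ, hδ, hclose⟩ := exists_norm_sub_partialSum_le hf hr0 hr1
  have hcf := continuous_comp_circleMap hf hr0 hr1
  have hblock : ∀ n, integralMean p r (block ω α n f) ≤
      A * (ENNReal.ofReal (r ^ blockStart ω α n) * hardyNorm p (block ω α n f)) := by
    intro n
    have h := (hA (coeff f) (blockStart ω α n) (cutIndex ω α (n + 1)) r hr0 hr1.le).1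
    rw [← hardyNorm_polynomial hp.le, ← blockIndices_eq_Ico] at h
    rw [← mul_assoc]
    exact h
  have hcb : ∀ n, Continuous fun θ => block ω α n f (circleMap 0 r θ) := fun n => by
    unfold block; fun_prop
  rw [← ENNReal.tsum_mul_left]
  set T := ∑' n, (A : ℝ≥0∞) *
    (ENNReal.ofReal (r ^ blockStart ω α n) * hardyNorm p (block ω α n f)) with hT
  have hlim : Tendsto (fun m => T + ENNReal.ofReal (δ (cutIndex ω α (m + 1)))) atTop (𝓝 T) := by
    have h1 : Tendsto (fun m => ENNReal.ofReal (δ (cutIndex ω α (m + 1)))) atTop (𝓝 0) := by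
      simpa using ENNReal.tendsto_ofReal (hδ.comp (hMt.comp (tendsto_add_atTop_nat 1)))
    simpa using h1.const_add T
  refine ge_of_tendsto' hlim fun m => ?_
  have h1 : eLpNorm (fun θ => ∑ n ∈ Finset.range (m + 1), block ω α n f (circleMap 0 r θ))
      (ENNReal.ofReal p) circleProb ≤ T := by
    have hfun : (fun θ => ∑ n ∈ Finset.range (m + 1), block ω α n f (circleMap 0 r θ)) =
        ∑ n ∈ Finset.range (m + 1), fun θ => block ω α n f (circleMap 0 r θ) := by
      funext θ; simp
    rw [hfun]
    refine (eLpNorm_sum_le (fun n _ => (memLp_circleProb (hcb n) 1).1)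
      (ENNReal.one_le_ofReal.2 hp.le)).trans ?_
    refine (Finset.sum_le_sum fun n _ => ?_).trans (ENNReal.sum_le_tsum _)
    rw [← integralMean_eq_eLpNorm hp0]
    exact hblock n
  rw [integralMean_eq_eLpNorm hp0]
  refine (eLpNorm_circleProb_le_of_norm_sub_le hp.le hcf
    (continuous_finsetSum _ fun n _ => hcb n) fun θ => ?_).trans (add_le_add h1 le_rfl)
  rw [sum_block hM]
  exact hclose _ _ (by simp [abs_of_nonneg hr0])

/-- Compare the block on the unit circle with itself at radius `r`, then use that extracting a block
is bounded on that circle. -/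
theorem exists_hardyNorm_block_le {p : ℝ} (hp : 1 < p) :
    ∃ A : ℝ≥0, ∀ (ω : ℝ → ℝ) (α : ℝ) (f : ℂ → ℂ),
      DifferentiableOn ℂ f (Metric.ball 0 1) → ∀ (n : ℕ) (r : ℝ), 0 ≤ r → r < 1 →
      ENNReal.ofReal (r ^ cutIndex ω α (n + 1)) * hardyNorm p (block ω α n f) ≤
        A * integralMean p r f := by
  obtain ⟨A, hA⟩ := exists_integralMean_Ico_le hp
  obtain ⟨B, hB⟩ := exists_integralMean_Ico_coeff_le hp
  refine ⟨A * B, fun ω α f hf n r hr0 hr1 => ?_⟩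
  have h := (hA (coeff f) (blockStart ω α n) (cutIndex ω α (n + 1)) r hr0 hr1.le).2
  rw [← hardyNorm_polynomial hp.le, ← blockIndices_eq_Ico] at h
  refine h.trans ?_
  rw [ENNReal.coe_mul, mul_assoc]
  gcongr
  rw [blockIndices_eq_Ico]
  exact hB f hf _ _ r hr0 hr1

/-! ### Tail integrals and cut radii -/

theorem intervalIntegrable_of_integral_eq_one {ω : ℝ → ℝ} (h1 : ∫ r in (0 : ℝ)..1, ω r = 1)
    {a b : ℝ} (ha : 0 ≤ a) (hab : a ≤ b) (hb : b ≤ 1) : IntervalIntegrable ω volume a b := by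
  have hi : IntervalIntegrable ω volume 0 1 := by
    by_contra h
    rw [intervalIntegral.integral_undef h] at h1
    exact zero_ne_one h1
  refine hi.mono_set ?_
  rw [uIcc_of_le hab, uIcc_of_le zero_le_one]
  exact Icc_subset_Icc ha hb

theorem tail_pos {ω : ℝ → ℝ} (hω : IsRadialWeight ω) (h1 : ∫ r in (0 : ℝ)..1, ω r = 1) {r : ℝ}
    (hr : r ∈ Ico (0 : ℝ) 1) : 0 < tail ω r :=
  intervalIntegral.intervalIntegral_pos_of_pos_on
    (intervalIntegrable_of_integral_eq_one h1 hr.1 hr.2.le le_rfl)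
    (fun x hx => hω.pos x ⟨hr.1.trans hx.1.le, hx.2⟩) hr.2

theorem continuousOn_tail {ω : ℝ → ℝ} (h1 : ∫ r in (0 : ℝ)..1, ω r = 1) :
    ContinuousOn (tail ω) (Icc 0 1) := by
  have := intervalIntegral.continuousOn_primitive_interval_left (a := (0 : ℝ)) (b := 1)
    (f := ω) (μ := volume) (by
      rw [uIcc_of_le zero_le_one]
      exact (intervalIntegrable_iff_integrableOn_Icc_of_le zero_le_one).1
        (intervalIntegrable_of_integral_eq_one h1 le_rfl zero_le_one le_rfl))
  rwa [uIcc_of_le zero_le_one] at this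

theorem hasDerivAt_tail {ω : ℝ → ℝ} (hc : ContinuousOn ω (Ico 0 1))
    (h1 : ∫ r in (0 : ℝ)..1, ω r = 1) {r : ℝ} (hr : r ∈ Ioo (0 : ℝ) 1) :
    HasDerivAt (tail ω) (-ω r) r := by
  have hc' : ContinuousOn ω (Ioo 0 1) := hc.mono Ioo_subset_Ico_self
  exact intervalIntegral.integral_hasDerivAt_left
    (intervalIntegrable_of_integral_eq_one h1 hr.1.le hr.2.le le_rfl)
    (hc'.stronglyMeasurableAtFilter isOpen_Ioo r hr) (hc'.continuousAt (isOpen_Ioo.mem_nhds hr))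

/-- The distortion function of a regular or rapidly increasing weight is bounded below by a
multiple of `1 - r`. -/
theorem exists_le_distortion {ω : ℝ → ℝ} (hω : IsRapidlyIncreasing ω ∨ IsRegular ω)
    (h1 : ∫ r in (0 : ℝ)..1, ω r = 1) :
    ∃ c : ℝ, 0 < c ∧ ∀ r ∈ Ico (0 : ℝ) 1, c * (1 - r) ≤ distortion ω r := by
  rcases hω with hω | hω
  · obtain ⟨ρ, hρ1, hρ⟩ : ∃ ρ < (1 : ℝ), ∀ r ∈ Ioo ρ 1, 1 ≤ distortion ω r / (1 - r) := by
      have := (hω.tendsto.eventually_ge_atTop 1)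
      rw [Filter.Eventually, mem_nhdsLT_iff_exists_Ioo_subset] at this
      obtain ⟨l, hl, hsub⟩ := this
      exact ⟨l, hl, hsub⟩
    set R := max ρ 0 with hR
    have hR1 : R < 1 := max_lt hρ1 zero_lt_one
    have hR0 : 0 ≤ R := le_max_right _ _
    obtain ⟨W, hW⟩ := isCompact_Icc.exists_bound_of_continuousOn
      (hω.continuousOn.mono (Icc_subset_Ico_right hR1 : Icc 0 R ⊆ Ico 0 1))
    have hW0 : 0 < W := by
      have := hW 0 ⟨le_rfl, hR0⟩
      exact (norm_pos_iff.2 (hω.weight.pos 0 ⟨le_rfl, zero_lt_one⟩).ne').trans_le this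
    have hT := tail_pos hω.weight h1 ⟨hR0, hR1⟩
    -- Beyond `R` the ratio is at least `1`. On `[0, R]` the tail is at least `tail ω R`, the weight
    -- at most `W`, and `1 - r ≤ 1`.
    refine ⟨min 1 (tail ω R / W), lt_min one_pos (by positivity), fun r hr => ?_⟩
    have h1r : 0 < 1 - r := by linarith [hr.2]
    rcases le_or_gt r R with h | h
    · have hωr := hω.weight.pos r hr
      have hTr := tail_pos hω.weight h1 hr
      have hωW : ω r ≤ W := (le_abs_self _).trans (hW r ⟨hr.1, h⟩)
      have htail : tail ω R ≤ tail ω r :=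
        (tail_strictAntiOn hω.weight h1).antitoneOn hr ⟨hR0, hR1⟩ h
      calc min 1 (tail ω R / W) * (1 - r) ≤ (tail ω R / W) * 1 := by
            gcongr
            · exact min_le_right _ _
            · linarith [hr.1]
        _ ≤ tail ω r / ω r := by rw [mul_one]; gcongr
        _ = distortion ω r := by rw [distortion, tail]; ring
    · have := hρ r ⟨(le_max_left _ _).trans_lt h, hr.2⟩
      rw [le_div_iff₀ h1r] at this
      calc _ ≤ 1 * (1 - r) := by gcongr; exact min_le_left _ _
        _ ≤ _ := this
  · obtain ⟨c, _, hc, _, h⟩ := hω.comparable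
    exact ⟨c, hc, fun r hr => (h r hr).1⟩

theorem isRadialWeight_of_or {ω : ℝ → ℝ} (hω : IsRapidlyIncreasing ω ∨ IsRegular ω) :
    IsRadialWeight ω := hω.elim (fun h => h.weight) fun h => h.weight

/-- The tail integral decays at most polynomially. -/
theorem exists_monotoneOn_log_tail {ω : ℝ → ℝ} (hω : IsRapidlyIncreasing ω ∨ IsRegular ω)
    (h1 : ∫ r in (0 : ℝ)..1, ω r = 1) :
    ∃ b : ℝ, 0 < b ∧
      MonotoneOn (fun r => Real.log (tail ω r) - b * Real.log (1 - r)) (Ico 0 1) := by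
  obtain ⟨c, hc, hdist⟩ := exists_le_distortion hω h1
  have hw := isRadialWeight_of_or hω
  have hcont : ContinuousOn ω (Ico 0 1) :=
    hω.elim (fun h => h.continuousOn) fun h => h.continuousOn
  -- The derivative is `(1 / c) / (1 - r) - ω / ω̂`, which is nonnegative exactly when `c (1 - r) ≤
  -- ω̂ / ω`.
  refine ⟨1 / c, by positivity, ?_⟩
  have hderiv : ∀ r ∈ Ioo (0 : ℝ) 1,
      HasDerivAt (fun r => Real.log (tail ω r) - 1 / c * Real.log (1 - r))
        (-ω r / tail ω r - 1 / c * (-1 / (1 - r))) r := by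
    intro r hr
    have hT := tail_pos hw h1 (Ioo_subset_Ico_self hr)
    have h2 : HasDerivAt (fun r : ℝ => 1 - r) (-1) r := by
      simpa using (hasDerivAt_id r).const_sub 1
    exact ((hasDerivAt_tail hcont h1 hr).log hT.ne').sub
      ((h2.log (sub_pos.2 hr.2).ne').const_mul (1 / c))
  refine monotoneOn_of_deriv_nonneg (convex_Ico 0 1) ?_ ?_ ?_
  · refine ContinuousOn.sub (ContinuousOn.log ((continuousOn_tail h1).mono Ico_subset_Icc_self)
      fun r hr => (tail_pos hw h1 hr).ne') (continuousOn_const.mul (ContinuousOn.log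
      (by fun_prop) fun r hr => ?_))
    have := hr.2
    exact (sub_pos.2 this).ne'
  · rw [interior_Ico]
    exact fun r hr => (hderiv r hr).differentiableAt.differentiableWithinAt
  · rw [interior_Ico]
    intro r hr
    rw [(hderiv r hr).deriv]
    have hT := tail_pos hw h1 (Ioo_subset_Ico_self hr)
    have hωr := hw.pos r (Ioo_subset_Ico_self hr)
    have h1r : 0 < 1 - r := by linarith [hr.2]
    have h := hdist r (Ioo_subset_Ico_self hr)
    have h2 : distortion ω r = tail ω r / ω r := by rw [distortion, tail]; ring
    rw [h2, le_div_iff₀ hωr] at h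
    have h3 : ω r / tail ω r ≤ 1 / c * (1 / (1 - r)) := by
      rw [div_le_iff₀ hT]
      calc ω r = 1 / c * (1 / (1 - r)) * (c * (1 - r) * ω r) := by field_simp
        _ ≤ _ := by gcongr
    have h4 : -ω r / tail ω r - 1 / c * (-1 / (1 - r)) =
        1 / c * (1 / (1 - r)) - ω r / tail ω r := by ring
    rw [h4]
    linarith

theorem two_rpow_neg_mul (n : ℕ) (s : ℝ) : (2 : ℝ) ^ (-(n * s)) = ((2 : ℝ) ^ (-s)) ^ n := by
  rw [← Real.rpow_natCast, ← Real.rpow_mul zero_le_two]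
  congr 1
  ring

theorem two_rpow_neg_mem {s : ℝ} (hs : 0 < s) : (2 : ℝ) ^ (-s) ∈ Ioo (0 : ℝ) 1 :=
  ⟨by positivity, Real.rpow_lt_one_of_one_lt_of_neg one_lt_two (by linarith)⟩

/-- The cut radii approach the boundary geometrically. -/
theorem exists_cutRadius_geometric {ω : ℝ → ℝ} (hω : IsRapidlyIncreasing ω ∨ IsRegular ω)
    (h1 : ∫ r in (0 : ℝ)..1, ω r = 1) {α : ℝ} (hα : 0 < α) :
    ∃ l : ℝ, 1 < l ∧ ∀ m j : ℕ,
      l ^ j * (1 - cutRadius ω α (m + j)) ≤ 1 - cutRadius ω α m := by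
  obtain ⟨b, hb, hmono⟩ := exists_monotoneOn_log_tail hω h1
  have hw := isRadialWeight_of_or hω
  have hlog2 : 0 < Real.log 2 := Real.log_pos one_lt_two
  -- From `r_m` to `r_{m+j}` the logarithm of the tail falls by `j α log 2`, which is at most `b`
  -- times the fall of `log (1 - r)`; thus `l = 2 ^ (α / b)`.
  refine ⟨Real.exp (α * Real.log 2 / b), Real.one_lt_exp_iff.2 (by positivity), fun m j => ?_⟩
  obtain ⟨hm, hmt⟩ := cutRadius_spec h1 hα m hw
  obtain ⟨hn, hnt⟩ := cutRadius_spec h1 hα (m + j) hw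
  have hanti := tail_strictAntiOn hw h1
  have hle : cutRadius ω α m ≤ cutRadius ω α (m + j) := by
    rw [← hanti.le_iff_ge hn hm, hmt, hnt]
    refine Real.rpow_le_rpow_of_exponent_le one_le_two ?_
    push_cast
    nlinarith [show (0 : ℝ) ≤ j from Nat.cast_nonneg j]
  have h := hmono hm hn hle
  simp only [hmt, hnt] at h
  rw [Real.log_rpow two_pos, Real.log_rpow two_pos] at h
  push_cast at h
  have hm1 : 0 < 1 - cutRadius ω α m := by linarith [hm.2]
  have hn1 : 0 < 1 - cutRadius ω α (m + j) := by linarith [hn.2]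
  rw [← Real.exp_nat_mul, ← Real.exp_log hm1, ← Real.exp_log hn1, ← Real.exp_add, Real.exp_le_exp]
  have h2 : (j : ℝ) * (α * Real.log 2 / b) = (j * α * Real.log 2) / b := by ring
  rw [h2, ← le_sub_iff_add_le, div_le_iff₀ hb]
  linarith

/-! ### Consequences of geometric decay: cut indices and powers of radii -/

section CutRadius

variable {ω : ℝ → ℝ} {α l : ℝ}

theorem monotone_cutRadius (hl : 1 < l) (hgeom : ∀ m j : ℕ,
    l ^ j * (1 - cutRadius ω α (m + j)) ≤ 1 - cutRadius ω α m)
    (hr1 : ∀ n, cutRadius ω α n < 1) : Monotone (cutRadius ω α) := by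
  refine monotone_nat_of_le_succ fun n => ?_
  have := hgeom n 1
  rw [pow_one] at this
  nlinarith [hr1 (n + 1)]

theorem pow_le_one_div_cutRadius (hgeom : ∀ m j : ℕ,
    l ^ j * (1 - cutRadius ω α (m + j)) ≤ 1 - cutRadius ω α m)
    (hr0 : ∀ n, 0 ≤ cutRadius ω α n) (hr1 : ∀ n, cutRadius ω α n < 1) (n : ℕ) :
    l ^ n ≤ 1 / (1 - cutRadius ω α n) := by
  rw [le_div_iff₀ (by linarith [hr1 n])]
  have := hgeom 0 n
  rw [zero_add] at this
  linarith [hr0 0]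

theorem monotone_cutIndex (hmono : Monotone (cutRadius ω α)) (hr1 : ∀ n, cutRadius ω α n < 1) :
    Monotone (cutIndex ω α) := by
  intro m n hmn
  refine Nat.floor_mono ?_
  have h1 := hr1 n
  have h2 := hmono hmn
  exact one_div_le_one_div_of_le (by linarith) (by linarith)

theorem tendsto_cutIndex (hl : 1 < l) (hgeom : ∀ m j : ℕ,
    l ^ j * (1 - cutRadius ω α (m + j)) ≤ 1 - cutRadius ω α m)
    (hr0 : ∀ n, 0 ≤ cutRadius ω α n) (hr1 : ∀ n, cutRadius ω α n < 1) :
    Tendsto (cutIndex ω α) atTop atTop :=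
  tendsto_nat_floor_atTop.comp (tendsto_atTop_mono (pow_le_one_div_cutRadius hgeom hr0 hr1)
    (tendsto_pow_atTop_atTop_of_one_lt hl))

theorem exists_mem_Ico_cutRadius (hl : 1 < l) (hgeom : ∀ m j : ℕ,
    l ^ j * (1 - cutRadius ω α (m + j)) ≤ 1 - cutRadius ω α m)
    (hr0 : ∀ n, 0 ≤ cutRadius ω α n) (hr1 : ∀ n, cutRadius ω α n < 1)
    (hzero : cutRadius ω α 0 = 0) {r : ℝ} (hr : r ∈ Ico (0 : ℝ) 1) :
    ∃ m, r ∈ Ico (cutRadius ω α m) (cutRadius ω α (m + 1)) := by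
  have hex : ∃ n, r < cutRadius ω α n := by
    obtain ⟨n, hn⟩ := ((tendsto_pow_atTop_atTop_of_one_lt hl).eventually_gt_atTop
      (1 / (1 - r))).exists
    refine ⟨n, ?_⟩
    have h := hn.trans_le (pow_le_one_div_cutRadius hgeom hr0 hr1 n)
    rw [one_div_lt_one_div (by linarith [hr.2]) (by linarith [hr1 n])] at h
    linarith
  classical
  have h0 : Nat.find hex ≠ 0 := by
    intro h
    have := Nat.find_spec hex
    rw [h, hzero] at this
    exact absurd this (not_lt.2 hr.1)
  obtain ⟨m, hm⟩ := Nat.exists_eq_succ_of_ne_zero h0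
  refine ⟨m, not_lt.1 (Nat.find_min hex (by omega)), ?_⟩
  have := Nat.find_spec hex
  rwa [hm] at this

/-- Rounding down a number that is at least `1` loses at most a factor `2`. -/
theorem one_le_two_mul_cutIndex_mul (hr0 : ∀ n, 0 ≤ cutRadius ω α n)
    (hr1 : ∀ n, cutRadius ω α n < 1) (n : ℕ) :
    1 ≤ 2 * (cutIndex ω α n * (1 - cutRadius ω α n)) := by
  have h1 : 0 < 1 - cutRadius ω α n := by linarith [hr1 n]
  have hx : 1 ≤ 1 / (1 - cutRadius ω α n) := by
    rw [le_div_iff₀ h1]; linarith [hr0 n]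
  have h2 : (1 : ℝ) ≤ cutIndex ω α n := by
    exact_mod_cast (Nat.one_le_floor_iff _).2 hx
  have h3 : 1 / (1 - cutRadius ω α n) < cutIndex ω α n + 1 := Nat.lt_floor_add_one _
  rw [div_lt_iff₀ h1] at h3
  nlinarith

/-- Since `r ≤ exp (-(1 - r))`, it suffices that `M_{m+j} (1 - r) ≥ l ^ j M_{m+j} (1 - r_{m+j}) ≥ l
^ j / 2`. -/
theorem pow_cutIndex_le (hgeom : ∀ m j : ℕ,
    l ^ j * (1 - cutRadius ω α (m + j)) ≤ 1 - cutRadius ω α m)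
    (hr0 : ∀ n, 0 ≤ cutRadius ω α n) (hr1 : ∀ n, cutRadius ω α n < 1) (m j : ℕ) {r : ℝ}
    (h0 : 0 ≤ r) (hr : r ≤ cutRadius ω α m) :
    r ^ cutIndex ω α (m + j) ≤ Real.exp (-(l ^ j / 2)) := by
  have h1 : r ≤ Real.exp (-(1 - r)) := by
    have := Real.add_one_le_exp (-(1 - r)); linarith
  have h2 := one_le_two_mul_cutIndex_mul hr0 hr1 (m + j)
  have h3 := hgeom m j
  have h4 : (0 : ℝ) ≤ cutIndex ω α (m + j) := Nat.cast_nonneg _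
  calc r ^ cutIndex ω α (m + j) ≤ Real.exp (-(1 - r)) ^ cutIndex ω α (m + j) := by gcongr
    _ = Real.exp (cutIndex ω α (m + j) * (-(1 - r))) := (Real.exp_nat_mul _ _).symm
    _ ≤ _ := by
      rw [Real.exp_le_exp, mul_neg, neg_le_neg_iff]
      have h5 : l ^ j * (1 - cutRadius ω α (m + j)) ≤ 1 - r := by linarith
      have hpos : 0 < 1 - cutRadius ω α (m + j) := by linarith [hr1 (m + j)]
      have h6 : (1 - r) * 1 ≤ (1 - r) * (2 * (cutIndex ω α (m + j) *
          (1 - cutRadius ω α (m + j)))) :=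
        mul_le_mul_of_nonneg_left h2 (by linarith [hr1 m])
      have h7 : l ^ j * (1 - cutRadius ω α (m + j)) ≤
          (2 * (cutIndex ω α (m + j) * (1 - r))) * (1 - cutRadius ω α (m + j)) := by linarith
      have h8 := le_of_mul_le_mul_right h7 hpos
      linarith

/-- With `s = r_{n+1}` and `M = M_{n+1}`, the bounds `log s ≥ 1 - 1 / s` and `M (1 - s) ≤ 1` give `s
^ M ≥ exp (-1 / s)`, and `s ≥ r_1` makes this uniform in `n`. -/
theorem le_pow_cutIndex (hmono : Monotone (cutRadius ω α)) (hr1 : ∀ n, cutRadius ω α n < 1)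
    (hpos : 0 < cutRadius ω α 1) (n : ℕ) {r : ℝ} (hr : cutRadius ω α (n + 1) ≤ r) :
    Real.exp (-(1 / cutRadius ω α 1)) ≤ r ^ cutIndex ω α (n + 1) := by
  have h1 : cutRadius ω α 1 ≤ cutRadius ω α (n + 1) := hmono (by omega)
  have hs := hpos.trans_le h1
  set s := cutRadius ω α (n + 1) with hsdef
  have hs1 : s < 1 := hr1 _
  have h2 : Real.exp (1 - s⁻¹) ≤ s := by
    rw [← Real.le_log_iff_exp_le hs]
    exact Real.one_sub_inv_le_log_of_pos hs
  have h3 : (cutIndex ω α (n + 1) : ℝ) * (1 - s) ≤ 1 := by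
    have := Nat.floor_le (a := 1 / (1 - s)) (by have : 0 < 1 - s := by linarith
                                                positivity)
    rwa [le_div_iff₀ (by linarith)] at this
  calc Real.exp (-(1 / cutRadius ω α 1)) ≤ Real.exp (cutIndex ω α (n + 1) * (1 - s⁻¹)) := by
        rw [Real.exp_le_exp]
        have h4 : (cutIndex ω α (n + 1) : ℝ) * (1 - s⁻¹) =
            -((cutIndex ω α (n + 1) * (1 - s)) * s⁻¹) := by field_simp; ring
        rw [h4, neg_le_neg_iff, one_div]
        calc _ ≤ 1 * s⁻¹ := by gcongr
          _ ≤ _ := by rw [one_mul]; gcongr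
    _ = Real.exp (1 - s⁻¹) ^ cutIndex ω α (n + 1) := Real.exp_nat_mul _ _
    _ ≤ s ^ cutIndex ω α (n + 1) := by gcongr
    _ ≤ _ := by gcongr

/-- The off-diagonal decay of the interaction of the radii in the `m`-th annulus with the `n`-th
block. -/
theorem exists_pow_blockStart_le (hl : 1 < l) (hgeom : ∀ m j : ℕ,
    l ^ j * (1 - cutRadius ω α (m + j)) ≤ 1 - cutRadius ω α m)
    (hr0 : ∀ n, 0 ≤ cutRadius ω α n) (hr1 : ∀ n, cutRadius ω α n < 1) {ρ : ℝ}
    (hρ : ρ ∈ Ioo (0 : ℝ) 1) :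
    ∃ C : ℝ, 0 < C ∧ ∀ (m n : ℕ) (r : ℝ), 0 ≤ r → r ≤ cutRadius ω α (m + 1) →
      ρ ^ m * r ^ blockStart ω α n ≤ C * (ρ ^ Nat.dist m n * ρ ^ n) := by
  -- With `l ^ N > ρ ^ (-2)`, one term of the exponential series, `y ^ N / N! ≤ exp y` at `y = l ^ j
  -- / 2`, already yields decay like `ρ ^ (2 * j)`.
  obtain ⟨N, hN⟩ := pow_unbounded_of_one_lt ((ρ ^ 2)⁻¹) hl
  have hρ0 := hρ.1
  have hC : ∀ j : ℕ, Real.exp (-(l ^ j / 2)) ≤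
      (2 ^ N * N.factorial * (ρ ^ 2)⁻¹) * (ρ ^ 2) ^ (j + 1) := by
    intro j
    have hy : 0 ≤ l ^ j := by positivity
    have h1 := Real.pow_div_factorial_le_exp (l ^ j / 2) (by positivity) N
    have h2 : ((ρ ^ 2)⁻¹) ^ j ≤ (l ^ j) ^ N := by
      rw [← pow_mul, mul_comm, pow_mul]
      exact pow_le_pow_left₀ (by positivity) hN.le j
    have h3 : (l ^ j) ^ N ≤ 2 ^ N * N.factorial * Real.exp (l ^ j / 2) := by
      rw [div_pow, div_div, div_le_iff₀ (by positivity)] at h1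
      linarith
    have h4 : ((ρ ^ 2)⁻¹) ^ j ≤ 2 ^ N * N.factorial * Real.exp (l ^ j / 2) := h2.trans h3
    rw [Real.exp_neg, inv_le_iff_one_le_mul₀ (Real.exp_pos _)]
    calc (1 : ℝ) = ((ρ ^ 2)⁻¹) ^ j * (ρ ^ 2) ^ j := by
          rw [← mul_pow, inv_mul_cancel₀ (by positivity), one_pow]
      _ ≤ (2 ^ N * N.factorial * Real.exp (l ^ j / 2)) * (ρ ^ 2) ^ j := by gcongr
      _ = _ := by
        rw [pow_succ (ρ ^ 2) j]
        field_simp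
  set D : ℝ := 2 ^ N * N.factorial * (ρ ^ 2)⁻¹ with hD
  have hD0 : 0 < D := by positivity
  refine ⟨max 1 D, by positivity, fun m n r h0 hr => ?_⟩
  have hr1' : r ≤ 1 := hr.trans (hr1 _).le
  -- For `n ≤ m` the target is `ρ ^ m` itself. For `n > m` it is `ρ ^ m * ρ ^ (2 * (n - m))`, hence
  -- the base `ρ ^ 2`. The radius is only below `r_{m+1}`, so one step of decay is lost and paid for
  -- by the factor `(ρ ^ 2)⁻¹` in `D`.
  rcases le_or_gt n m with hnm | hnm
  · rw [Nat.dist_eq_sub_of_le_right hnm, ← pow_add, Nat.sub_add_cancel hnm]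
    calc _ ≤ ρ ^ m * 1 := by gcongr; exact pow_le_one₀ h0 hr1'
      _ = 1 * ρ ^ m := by ring
      _ ≤ _ := by gcongr; exact le_max_left _ _
  · obtain ⟨j, rfl⟩ := Nat.exists_eq_add_of_lt hnm
    have hd : Nat.dist m (m + j + 1) = j + 1 := by
      rw [Nat.dist_eq_sub_of_le hnm.le]; omega
    have hb : blockStart ω α (m + j + 1) = cutIndex ω α ((m + 1) + j) := by
      rw [blockStart, if_neg (by omega)]; congr 1; omega
    rw [hd, hb]
    calc _ ≤ ρ ^ m * (D * (ρ ^ 2) ^ (j + 1)) := by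
          gcongr
          exact (pow_cutIndex_le hgeom hr0 hr1 (m + 1) j h0 hr).trans (hC j)
      _ = D * (ρ ^ (j + 1) * ρ ^ (m + j + 1)) := by ring
      _ ≤ _ := by gcongr; exact le_max_right _ _

end CutRadius

theorem cutRadius_zero {ω : ℝ → ℝ} (hω : IsRadialWeight ω) (h1 : ∫ r in (0 : ℝ)..1, ω r = 1)
    {α : ℝ} (hα : 0 < α) : cutRadius ω α 0 = 0 :=
  (cutRadius_unique hω h1 hα 0 ⟨le_rfl, zero_lt_one⟩ (by simpa [tail] using h1)).symm

theorem cutRadius_one_pos {ω : ℝ → ℝ} (hω : IsRadialWeight ω) (h1 : ∫ r in (0 : ℝ)..1, ω r = 1)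
    {α : ℝ} (hα : 0 < α) : 0 < cutRadius ω α 1 := by
  obtain ⟨h, ht⟩ := cutRadius_spec h1 hα 1 hω
  refine h.1.lt_of_ne fun h0 => ?_
  rw [← h0] at ht
  have h2 : tail ω 0 = 1 := h1
  rw [h2, two_rpow_neg_mul, pow_one] at ht
  exact (two_rpow_neg_mem hα).2.ne ht.symm

/-- The mass of the weight on the annulus between consecutive cut radii. -/
theorem lintegral_Ico_cutRadius {ω : ℝ → ℝ} (hω : IsRadialWeight ω)
    (h1 : ∫ r in (0 : ℝ)..1, ω r = 1) {α : ℝ} (hα : 0 < α) {m : ℕ}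
    (hle : cutRadius ω α m ≤ cutRadius ω α (m + 1)) :
    ∫⁻ r in Ico (cutRadius ω α m) (cutRadius ω α (m + 1)), ENNReal.ofReal (ω r) =
      ENNReal.ofReal (((2 : ℝ) ^ (-α)) ^ m * (1 - (2 : ℝ) ^ (-α))) := by
  obtain ⟨hm, hmt⟩ := cutRadius_spec h1 hα m hω
  obtain ⟨hn, hnt⟩ := cutRadius_spec h1 hα (m + 1) hω
  have hi := intervalIntegrable_of_integral_eq_one h1 hm.1 hle hn.2.le
  have hi1 := intervalIntegrable_of_integral_eq_one h1 hn.1 hn.2.le le_rfl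
  rw [← ofReal_integral_eq_lintegral_ofReal
    ((intervalIntegrable_iff_integrableOn_Ico_of_le hle).1 hi)
    ((ae_restrict_mem measurableSet_Ico).mono fun r hr =>
      (hω.pos r ⟨hm.1.trans hr.1, hr.2.trans hn.2⟩).le)]
  congr 1
  rw [integral_Ico_eq_integral_Ioc, ← intervalIntegral.integral_of_le hle]
  have := intervalIntegral.integral_add_adjacent_intervals hi hi1
  rw [tail] at hmt hnt
  rw [two_rpow_neg_mul] at hmt hnt
  rw [hmt, hnt] at this
  rw [pow_succ] at this
  linarith

/-! ### Discrete kernels with geometric decay off the diagonal -/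

/-- One geometric series on each side of the diagonal. For `κ ≥ 1` the right side is `∞` by
truncated subtraction. -/
theorem tsum_pow_dist_le (κ : ℝ≥0∞) (m : ℕ) :
    ∑' n, κ ^ Nat.dist m n ≤ 2 * (1 - κ)⁻¹ := by
  have h1 : ∑ n ∈ Finset.range m, κ ^ Nat.dist m n + ∑' n, κ ^ Nat.dist m (n + m) =
      ∑' n, κ ^ Nat.dist m n :=
    Summable.sum_add_tsum_nat_add' (f := fun n => κ ^ Nat.dist m n) ENNReal.summable
  rw [← h1, two_mul]
  refine add_le_add ?_ ?_
  · rw [← ENNReal.tsum_geometric, ← Finset.sum_range_reflect]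
    refine le_trans (Finset.sum_le_sum fun j hj => ?_)
      (ENNReal.sum_le_tsum (f := fun j => κ ^ (j + 1)) (Finset.range m)) |>.trans ?_
    · have := Finset.mem_range.1 hj
      rw [Nat.dist_eq_sub_of_le_right (by omega)]
      exact le_of_eq (by congr 1; omega)
    · exact ENNReal.tsum_comp_le_tsum_of_injective (add_left_injective 1) fun j => κ ^ j
  · rw [← ENNReal.tsum_geometric]
    refine ENNReal.tsum_le_tsum fun j => le_of_eq ?_
    rw [Nat.dist_eq_sub_of_le (by omega)]
    congr 1
    omega

theorem iSup_tsum_pow_dist_mul_le (κ : ℝ≥0∞) (b : ℕ → ℝ≥0∞) (m : ℕ) :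
    ∑' n, κ ^ Nat.dist m n * b n ≤ 2 * (1 - κ)⁻¹ * ⨆ n, b n := by
  calc _ ≤ ∑' n, κ ^ Nat.dist m n * ⨆ n, b n :=
        ENNReal.tsum_le_tsum fun n => by gcongr; exact le_iSup b n
    _ ≤ _ := by rw [ENNReal.tsum_mul_right]; gcongr; exact tsum_pow_dist_le κ m

/-- Split `ρ = κ * κ`. One factor `κ ^ |m - n|` is summed; the other stays with `b n` under a
supremum, which is at most an `ℓ ^ q` norm for every `q > 0`. Taking `q`-th powers and exchanging
the sums leaves a geometric series in `κ ^ q`, with no case distinction at `q = 1`. -/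
theorem exists_tsum_rpow_tsum_le {ρ q : ℝ} (hρ : ρ ∈ Ioo (0 : ℝ) 1) (hq : 0 < q) :
    ∃ D : ℝ≥0∞, D ≠ ∞ ∧ ∀ b : ℕ → ℝ≥0∞,
      ∑' m, (∑' n, ENNReal.ofReal ρ ^ Nat.dist m n * b n) ^ q ≤ D * ∑' n, b n ^ q := by
  set κ : ℝ≥0∞ := ENNReal.ofReal (Real.sqrt ρ) with hκ
  have hκ2 : ENNReal.ofReal ρ = κ * κ := by
    rw [hκ, ← ENNReal.ofReal_mul (Real.sqrt_nonneg _), Real.mul_self_sqrt hρ.1.le]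
  have hκ1 : κ < 1 := by
    rw [hκ, ENNReal.ofReal_lt_one, Real.sqrt_lt' one_pos]
    simpa using hρ.2
  have hκq : κ ^ q < 1 := ENNReal.rpow_lt_one hκ1 hq
  have hfin : ∀ x : ℝ≥0∞, x < 1 → 2 * (1 - x)⁻¹ ≠ ∞ := fun x hx =>
    ENNReal.mul_ne_top (by norm_num) (ENNReal.inv_ne_top.2 (tsub_pos_of_lt hx).ne')
  refine ⟨(2 * (1 - κ)⁻¹) ^ q * (2 * (1 - κ ^ q)⁻¹),
    ENNReal.mul_ne_top (ENNReal.rpow_ne_top_of_nonneg hq.le (hfin κ hκ1)) (hfin _ hκq),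
    fun b => ?_⟩
  have hpoint : ∀ m, (∑' n, ENNReal.ofReal ρ ^ Nat.dist m n * b n) ^ q ≤
      (2 * (1 - κ)⁻¹) ^ q * ∑' n, (κ ^ q) ^ Nat.dist m n * b n ^ q := by
    intro m
    set T := ∑' n, (κ ^ q) ^ Nat.dist m n * b n ^ q with hT
    have h1 : ∀ n, κ ^ Nat.dist m n * b n ≤ T ^ (1 / q) := by
      intro n
      rw [one_div, ENNReal.le_rpow_inv_iff hq, ENNReal.mul_rpow_of_nonneg _ _ hq.le]
      refine le_trans (le_of_eq ?_) (ENNReal.le_tsum n)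
      rw [← ENNReal.rpow_natCast, ← ENNReal.rpow_natCast, ← ENNReal.rpow_mul, ← ENNReal.rpow_mul,
        mul_comm (Nat.dist m n : ℝ) q]
    have h2 : ∑' n, ENNReal.ofReal ρ ^ Nat.dist m n * b n ≤ 2 * (1 - κ)⁻¹ * T ^ (1 / q) := by
      calc _ = ∑' n, κ ^ Nat.dist m n * (κ ^ Nat.dist m n * b n) := by
            refine tsum_congr fun n => ?_
            rw [hκ2, mul_pow, mul_assoc]
        _ ≤ _ := iSup_tsum_pow_dist_mul_le κ _ m
        _ ≤ _ := by gcongr; exact iSup_le h1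
    calc _ ≤ (2 * (1 - κ)⁻¹ * T ^ (1 / q)) ^ q := by gcongr
      _ = _ := by
        rw [ENNReal.mul_rpow_of_nonneg _ _ hq.le, ← ENNReal.rpow_mul, one_div_mul_cancel hq.ne',
          ENNReal.rpow_one]
  calc _ ≤ ∑' m, (2 * (1 - κ)⁻¹) ^ q * ∑' n, (κ ^ q) ^ Nat.dist m n * b n ^ q :=
        ENNReal.tsum_le_tsum hpoint
    _ = (2 * (1 - κ)⁻¹) ^ q * ∑' n, (∑' m, (κ ^ q) ^ Nat.dist n m) * b n ^ q := by
        rw [ENNReal.tsum_mul_left, ENNReal.tsum_comm]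
        congr 1
        refine tsum_congr fun n => ?_
        rw [ENNReal.tsum_mul_right]
        simp_rw [Nat.dist_comm]
    _ ≤ (2 * (1 - κ)⁻¹) ^ q * ∑' n, (2 * (1 - κ ^ q)⁻¹) * b n ^ q := by
        gcongr with n
        exact tsum_pow_dist_le _ n
    _ = _ := by rw [ENNReal.tsum_mul_left, ← mul_assoc]

/-! ### The block norms -/

/-- The weighted integral mean on the `m`-th annulus is controlled by the weighted block norms. -/
theorem exists_pow_mul_integralMean_le {p α ρ : ℝ} (hp : 1 < p) (hα : 0 < α) {ω : ℝ → ℝ}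
    (hω : IsRapidlyIncreasing ω ∨ IsRegular ω) (h1 : ∫ r in (0 : ℝ)..1, ω r = 1)
    (hρ : ρ ∈ Ioo (0 : ℝ) 1) :
    ∃ A : ℝ≥0, ∀ f : ℂ → ℂ, DifferentiableOn ℂ f (Metric.ball 0 1) → ∀ (m : ℕ) (r : ℝ),
      r ∈ Ico (cutRadius ω α m) (cutRadius ω α (m + 1)) →
      ENNReal.ofReal (ρ ^ m) * integralMean p r f ≤ A * ∑' n, ENNReal.ofReal ρ ^ Nat.dist m n *
        (ENNReal.ofReal (ρ ^ n) * hardyNorm p (block ω α n f)) := by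
  have hw := isRadialWeight_of_or hω
  have hr0 : ∀ n, 0 ≤ cutRadius ω α n := fun n => (cutRadius_spec h1 hα n hw).1.1
  have hr1 : ∀ n, cutRadius ω α n < 1 := fun n => (cutRadius_spec h1 hα n hw).1.2
  obtain ⟨l, hl, hgeom⟩ := exists_cutRadius_geometric hω h1 hα
  have hmono := monotone_cutRadius hl hgeom hr1
  obtain ⟨A, hA⟩ := exists_integralMean_le_tsum hp
  obtain ⟨C, hC0, hC⟩ := exists_pow_blockStart_le hl hgeom hr0 hr1 hρ
  refine ⟨A * C.toNNReal, fun f hf m r hr => ?_⟩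
  have hr' : 0 ≤ r := (hr0 m).trans hr.1
  have h := hA ω α (monotone_cutIndex hmono hr1) (tendsto_cutIndex hl hgeom hr0 hr1) f hf r hr'
    (hr.2.trans (hr1 _))
  have hρ0 := hρ.1.le
  calc _ ≤ ENNReal.ofReal (ρ ^ m) * (A * ∑' n, ENNReal.ofReal (r ^ blockStart ω α n) *
          hardyNorm p (block ω α n f)) := by gcongr
    _ = A * ∑' n, ENNReal.ofReal (ρ ^ m * r ^ blockStart ω α n) *
          hardyNorm p (block ω α n f) := by
        rw [mul_left_comm, ← ENNReal.tsum_mul_left]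
        congr 1
        refine tsum_congr fun n => ?_
        rw [ENNReal.ofReal_mul (by positivity), mul_assoc]
    _ ≤ A * ∑' n, ENNReal.ofReal (C * (ρ ^ Nat.dist m n * ρ ^ n)) *
          hardyNorm p (block ω α n f) := by
        refine mul_le_mul_right (ENNReal.tsum_le_tsum fun n => ?_) _
        exact mul_le_mul_left (ENNReal.ofReal_le_ofReal (hC m n r hr' hr.2.le)) _
    _ = _ := by
        rw [ENNReal.coe_mul, mul_assoc, ← ENNReal.tsum_mul_left (a := ((C.toNNReal : ℝ≥0) : ℝ≥0∞))]
        congr 1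
        refine tsum_congr fun n => ?_
        rw [ENNReal.ofReal_mul hC0.le, ENNReal.ofReal_mul (by positivity),
          ENNReal.ofReal_pow hρ0 (Nat.dist m n)]
        simp only [ENNReal.ofReal, mul_assoc]

/-- The block norms are controlled by the integral means outside the corresponding cut radius. -/
theorem exists_hardyNorm_block_le_integralMean {p α : ℝ} (hp : 1 < p) (hα : 0 < α) {ω : ℝ → ℝ}
    (hω : IsRapidlyIncreasing ω ∨ IsRegular ω) (h1 : ∫ r in (0 : ℝ)..1, ω r = 1) :
    ∃ A : ℝ≥0, ∀ f : ℂ → ℂ, DifferentiableOn ℂ f (Metric.ball 0 1) → ∀ (n : ℕ) (r : ℝ),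
      cutRadius ω α (n + 1) ≤ r → r < 1 →
      hardyNorm p (block ω α n f) ≤ A * integralMean p r f := by
  have hw := isRadialWeight_of_or hω
  have hr0 : ∀ n, 0 ≤ cutRadius ω α n := fun n => (cutRadius_spec h1 hα n hw).1.1
  have hr1 : ∀ n, cutRadius ω α n < 1 := fun n => (cutRadius_spec h1 hα n hw).1.2
  obtain ⟨l, hl, hgeom⟩ := exists_cutRadius_geometric hω h1 hα
  have hmono := monotone_cutRadius hl hgeom hr1
  have hpos := cutRadius_one_pos hw h1 hα
  obtain ⟨A, hA⟩ := exists_hardyNorm_block_le hp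
  set e := Real.exp (-(1 / cutRadius ω α 1)) with he
  have he0 : 0 < e := Real.exp_pos _
  refine ⟨(e⁻¹).toNNReal * A, fun f hf n r hr hr1' => ?_⟩
  have h := hA ω α f hf n r ((hr0 _).trans hr) hr1'
  have h2 : ENNReal.ofReal e * hardyNorm p (block ω α n f) ≤ A * integralMean p r f :=
    le_trans (by gcongr; exact le_pow_cutIndex hmono hr1 hpos n hr) h
  calc _ = ENNReal.ofReal e⁻¹ * (ENNReal.ofReal e * hardyNorm p (block ω α n f)) := by
        rw [← mul_assoc, ← ENNReal.ofReal_mul (by positivity), inv_mul_cancel₀ he0.ne',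
          ENNReal.ofReal_one, one_mul]
    _ ≤ ENNReal.ofReal e⁻¹ * (A * integralMean p r f) := by gcongr
    _ = _ := by rw [ENNReal.coe_mul, mul_assoc]; rfl

/-! ### The two estimates for finite `q` -/

theorem blockSum_eq (p α : ℝ) {q : ℝ} (hq : 0 < q) (ω : ℝ → ℝ) (f : ℂ → ℂ) :
    blockSum p q ω α f = ∑' n, (ENNReal.ofReal (((2 : ℝ) ^ (-(α / q))) ^ n) *
      hardyNorm p (block ω α n f)) ^ q := by
  refine tsum_congr fun n => ?_
  rw [ENNReal.mul_rpow_of_nonneg _ _ hq.le, ENNReal.ofReal_rpow_of_nonneg (by positivity) hq.le,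
    ← two_rpow_neg_mul, ← Real.rpow_mul zero_le_two]
  congr 3
  field_simp

/-- On the `m`-th annulus the mean is at most `ρ ^ (-m)` times the kernel sum, and the mass of the
weight is at most `ρ ^ (m q)`. These powers cancel in the integral, and the `ℓ ^ q` bound for the
kernel sums the annuli. -/
theorem exists_mixedNorm_le {p q α : ℝ} (hp : 1 < p) (hq : 0 < q) (hα : 0 < α) {ω : ℝ → ℝ}
    (hω : IsRapidlyIncreasing ω ∨ IsRegular ω) (h1 : ∫ r in (0 : ℝ)..1, ω r = 1) :
    ∃ K : ℝ≥0∞, K ≠ ∞ ∧ ∀ f : ℂ → ℂ, DifferentiableOn ℂ f (Metric.ball 0 1) →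
      mixedNorm p q ω f ≤ K * blockSum p q ω α f ^ (1 / q) := by
  have hw := isRadialWeight_of_or hω
  have hr0 : ∀ n, 0 ≤ cutRadius ω α n := fun n => (cutRadius_spec h1 hα n hw).1.1
  have hr1 : ∀ n, cutRadius ω α n < 1 := fun n => (cutRadius_spec h1 hα n hw).1.2
  obtain ⟨l, hl, hgeom⟩ := exists_cutRadius_geometric hω h1 hα
  have hmono := monotone_cutRadius hl hgeom hr1
  set ρ : ℝ := (2 : ℝ) ^ (-(α / q)) with hρdef
  have hρ : ρ ∈ Ioo (0 : ℝ) 1 := two_rpow_neg_mem (by positivity)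
  have hρq : ∀ m : ℕ, (ρ ^ m) ^ q = ((2 : ℝ) ^ (-α)) ^ m := by
    intro m
    rw [← Real.rpow_natCast, ← Real.rpow_natCast, ← Real.rpow_mul hρ.1.le, mul_comm,
      Real.rpow_mul hρ.1.le, hρdef, ← Real.rpow_mul zero_le_two]
    congr 2
    field_simp
  obtain ⟨A, hA⟩ := exists_pow_mul_integralMean_le hp hα hω h1 hρ
  obtain ⟨D, hD, hDle⟩ := exists_tsum_rpow_tsum_le hρ hq
  have hτ := two_rpow_neg_mem hα
  have hρ0 := hρ.1
  refine ⟨((A : ℝ≥0∞) ^ q * D) ^ (1 / q), ENNReal.rpow_ne_top_of_nonneg (by positivity)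
    (ENNReal.mul_ne_top (ENNReal.rpow_ne_top_of_nonneg hq.le ENNReal.coe_ne_top) hD),
    fun f hf => ?_⟩
  rw [mixedNorm, ← ENNReal.mul_rpow_of_nonneg _ _ (by positivity : 0 ≤ 1 / q)]
  gcongr
  rw [blockSum_eq p α hq, mul_assoc]
  set b : ℕ → ℝ≥0∞ := fun n => ENNReal.ofReal (ρ ^ n) * hardyNorm p (block ω α n f) with hb
  set E : ℕ → ℝ≥0∞ := fun m => ∑' n, ENNReal.ofReal ρ ^ Nat.dist m n * b n with hE
  have hpiece : ∀ m, ∫⁻ r in Ico (cutRadius ω α m) (cutRadius ω α (m + 1)),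
      integralMean p r f ^ q * ENNReal.ofReal (ω r) ≤ (A : ℝ≥0∞) ^ q * E m ^ q := by
    intro m
    have hle := hmono (Nat.le_succ m)
    set τ : ℝ≥0∞ := ENNReal.ofReal (((2 : ℝ) ^ (-α)) ^ m) with hτm
    have hτ0 : τ ≠ 0 := by
      rw [hτm, Ne, ENNReal.ofReal_eq_zero, not_le]
      exact pow_pos hτ.1 m
    have hτtop : τ ≠ ∞ := ENNReal.ofReal_ne_top
    have hpt : ∀ r ∈ Ico (cutRadius ω α m) (cutRadius ω α (m + 1)),
        integralMean p r f ^ q ≤ (A : ℝ≥0∞) ^ q * E m ^ q / τ := by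
      intro r hr
      rw [ENNReal.le_div_iff_mul_le (Or.inl hτ0) (Or.inl hτtop), mul_comm, hτm, ← hρq,
        ← ENNReal.ofReal_rpow_of_nonneg (by positivity) hq.le,
        ← ENNReal.mul_rpow_of_nonneg _ _ hq.le, ← ENNReal.mul_rpow_of_nonneg _ _ hq.le]
      exact ENNReal.rpow_le_rpow (hA f hf m r hr) hq.le
    have hmeas : AEMeasurable (fun r => ENNReal.ofReal (ω r))
        (volume.restrict (Ico (cutRadius ω α m) (cutRadius ω α (m + 1)))) := by
      have := (intervalIntegrable_iff_integrableOn_Ico_of_le hle).1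
        (intervalIntegrable_of_integral_eq_one h1 (hr0 m) hle (hr1 _).le)
      exact this.aemeasurable.ennreal_ofReal
    calc _ ≤ ∫⁻ r in Ico (cutRadius ω α m) (cutRadius ω α (m + 1)),
            (A : ℝ≥0∞) ^ q * E m ^ q / τ * ENNReal.ofReal (ω r) := by
          refine setLIntegral_mono' measurableSet_Ico fun r hr => ?_
          gcongr
          exact hpt r hr
      _ = (A : ℝ≥0∞) ^ q * E m ^ q / τ *
            ENNReal.ofReal (((2 : ℝ) ^ (-α)) ^ m * (1 - (2 : ℝ) ^ (-α))) := by
          rw [lintegral_const_mul'' _ hmeas, lintegral_Ico_cutRadius hw h1 hα hle]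
      _ ≤ (A : ℝ≥0∞) ^ q * E m ^ q / τ * τ := by
          refine mul_le_mul_right (ENNReal.ofReal_le_ofReal ?_) _
          exact mul_le_of_le_one_right (pow_pos hτ.1 m).le (by linarith [hτ.1])
      _ = _ := ENNReal.div_mul_cancel hτ0 hτtop
  have hcover : Ioo (0 : ℝ) 1 ⊆ ⋃ m, Ico (cutRadius ω α m) (cutRadius ω α (m + 1)) := by
    intro r hr
    exact mem_iUnion.2 (exists_mem_Ico_cutRadius hl hgeom hr0 hr1 (cutRadius_zero hw h1 hα)
      (Ioo_subset_Ico_self hr))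
  calc _ ≤ ∫⁻ r in ⋃ m, Ico (cutRadius ω α m) (cutRadius ω α (m + 1)),
          integralMean p r f ^ q * ENNReal.ofReal (ω r) := lintegral_mono_set hcover
    _ ≤ ∑' m, ∫⁻ r in Ico (cutRadius ω α m) (cutRadius ω α (m + 1)),
          integralMean p r f ^ q * ENNReal.ofReal (ω r) := lintegral_iUnion_le _ _
    _ ≤ ∑' m, (A : ℝ≥0∞) ^ q * E m ^ q := ENNReal.tsum_le_tsum hpiece
    _ = (A : ℝ≥0∞) ^ q * ∑' m, E m ^ q := ENNReal.tsum_mul_left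
    _ ≤ _ := by gcongr; exact hDle b

/-- Block `n` is tested on `[r_{n+1}, r_{n+2})`, where its norm is controlled by the mean of `f` and
the weight has mass `τ (1 - τ) τ ^ n`, with `τ = 2 ^ (-α)`. These annuli are disjoint subsets of
`(0, 1)`. -/
theorem exists_blockSum_le {p q α : ℝ} (hp : 1 < p) (hq : 0 < q) (hα : 0 < α) {ω : ℝ → ℝ}
    (hω : IsRapidlyIncreasing ω ∨ IsRegular ω) (h1 : ∫ r in (0 : ℝ)..1, ω r = 1) :
    ∃ K : ℝ≥0∞, K ≠ ∞ ∧ ∀ f : ℂ → ℂ, DifferentiableOn ℂ f (Metric.ball 0 1) →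
      blockSum p q ω α f ^ (1 / q) ≤ K * mixedNorm p q ω f := by
  have hw := isRadialWeight_of_or hω
  have hr0 : ∀ n, 0 ≤ cutRadius ω α n := fun n => (cutRadius_spec h1 hα n hw).1.1
  have hr1 : ∀ n, cutRadius ω α n < 1 := fun n => (cutRadius_spec h1 hα n hw).1.2
  obtain ⟨l, hl, hgeom⟩ := exists_cutRadius_geometric hω h1 hα
  have hmono := monotone_cutRadius hl hgeom hr1
  obtain ⟨A, hA⟩ := exists_hardyNorm_block_le_integralMean hp hα hω h1
  have hτ := two_rpow_neg_mem hα
  set τ : ℝ := (2 : ℝ) ^ (-α) with hτdef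
  set B : ℝ≥0∞ := ENNReal.ofReal (τ * (1 - τ)) with hB
  have hB0 : B ≠ 0 := by
    rw [hB, Ne, ENNReal.ofReal_eq_zero, not_le]
    exact mul_pos hτ.1 (sub_pos.2 hτ.2)
  have hBtop : B ≠ ∞ := ENNReal.ofReal_ne_top
  refine ⟨(B⁻¹ * (A : ℝ≥0∞) ^ q) ^ (1 / q), ENNReal.rpow_ne_top_of_nonneg (by positivity)
    (ENNReal.mul_ne_top (ENNReal.inv_ne_top.2 hB0)
      (ENNReal.rpow_ne_top_of_nonneg hq.le ENNReal.coe_ne_top)), fun f hf => ?_⟩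
  rw [mixedNorm, ← ENNReal.mul_rpow_of_nonneg _ _ (by positivity : 0 ≤ 1 / q)]
  gcongr
  have hpiece : ∀ n, B * (ENNReal.ofReal (τ ^ n) * hardyNorm p (block ω α n f) ^ q) ≤
      (A : ℝ≥0∞) ^ q * ∫⁻ r in Ico (cutRadius ω α (n + 1)) (cutRadius ω α (n + 1 + 1)),
        integralMean p r f ^ q * ENNReal.ofReal (ω r) := by
    intro n
    have hle := hmono (Nat.le_succ (n + 1))
    calc _ = hardyNorm p (block ω α n f) ^ q * ENNReal.ofReal (τ ^ (n + 1) * (1 - τ)) := by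
          have : τ ^ (n + 1) * (1 - τ) = (τ * (1 - τ)) * τ ^ n := by ring
          rw [this, ENNReal.ofReal_mul (mul_pos hτ.1 (sub_pos.2 hτ.2)).le]
          ring
      _ ≤ ∫⁻ r in Ico (cutRadius ω α (n + 1)) (cutRadius ω α (n + 1 + 1)),
            hardyNorm p (block ω α n f) ^ q * ENNReal.ofReal (ω r) := by
          rw [← lintegral_Ico_cutRadius hw h1 hα hle]
          exact lintegral_const_mul_le _ _
      _ ≤ ∫⁻ r in Ico (cutRadius ω α (n + 1)) (cutRadius ω α (n + 1 + 1)),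
            (A : ℝ≥0∞) ^ q * (integralMean p r f ^ q * ENNReal.ofReal (ω r)) := by
          refine setLIntegral_mono' measurableSet_Ico fun r hr => ?_
          rw [← mul_assoc, ← ENNReal.mul_rpow_of_nonneg _ _ hq.le]
          gcongr
          exact hA f hf n r hr.1 (hr.2.trans (hr1 _))
      _ = _ := lintegral_const_mul' _ _ (ENNReal.rpow_ne_top_of_nonneg hq.le ENNReal.coe_ne_top)
  have hsub : (⋃ n, Ico (cutRadius ω α (n + 1)) (cutRadius ω α (n + 1 + 1))) ⊆ Ioo 0 1 := by
    refine iUnion_subset fun n r hr => ⟨?_, hr.2.trans (hr1 _)⟩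
    exact (cutRadius_one_pos hw h1 hα).trans_le ((hmono (by omega : 1 ≤ n + 1)).trans hr.1)
  have hdisj : Pairwise (Function.onFun Disjoint fun n : ℕ =>
      Ico (cutRadius ω α (n + 1)) (cutRadius ω α (n + 1 + 1))) :=
    (show Monotone fun n => cutRadius ω α (n + 1) from
      fun m n h => hmono (Nat.succ_le_succ h)).pairwise_disjoint_on_Ico_succ
  have hmain : B * blockSum p q ω α f ≤ (A : ℝ≥0∞) ^ q *
      ∫⁻ r in Ioo (0 : ℝ) 1, integralMean p r f ^ q * ENNReal.ofReal (ω r) := by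
    calc _ = ∑' n, B * (ENNReal.ofReal (τ ^ n) * hardyNorm p (block ω α n f) ^ q) := by
          rw [blockSum, ← ENNReal.tsum_mul_left]
          refine tsum_congr fun n => ?_
          rw [two_rpow_neg_mul]
      _ ≤ _ := ENNReal.tsum_le_tsum hpiece
      _ = (A : ℝ≥0∞) ^ q * ∫⁻ r in ⋃ n, Ico (cutRadius ω α (n + 1)) (cutRadius ω α (n + 1 + 1)),
            integralMean p r f ^ q * ENNReal.ofReal (ω r) := by
          rw [ENNReal.tsum_mul_left, lintegral_iUnion (fun _ => measurableSet_Ico) hdisj]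
      _ ≤ _ := by gcongr
  calc _ = B⁻¹ * (B * blockSum p q ω α f) := by
        rw [← mul_assoc, ENNReal.inv_mul_cancel hB0 hBtop, one_mul]
    _ ≤ _ := by rw [mul_assoc]; gcongr

/-! ### The two estimates for the supremum norm -/

theorem exists_mixedSupNorm_le {p α β : ℝ} (hp : 1 < p) (hβ : 0 < β) (hα : 0 < α) {ω : ℝ → ℝ}
    (hω : IsRapidlyIncreasing ω ∨ IsRegular ω) (h1 : ∫ r in (0 : ℝ)..1, ω r = 1) :
    ∃ K : ℝ≥0∞, K ≠ ∞ ∧ ∀ f : ℂ → ℂ, DifferentiableOn ℂ f (Metric.ball 0 1) →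
      mixedSupNorm p (fun r => tail ω r ^ β) f ≤ K * blockSup p β ω α f := by
  have hw := isRadialWeight_of_or hω
  have hr0 : ∀ n, 0 ≤ cutRadius ω α n := fun n => (cutRadius_spec h1 hα n hw).1.1
  have hr1 : ∀ n, cutRadius ω α n < 1 := fun n => (cutRadius_spec h1 hα n hw).1.2
  obtain ⟨l, hl, hgeom⟩ := exists_cutRadius_geometric hω h1 hα
  set ρ : ℝ := (2 : ℝ) ^ (-(α * β)) with hρdef
  have hρ : ρ ∈ Ioo (0 : ℝ) 1 := two_rpow_neg_mem (by positivity)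
  obtain ⟨A, hA⟩ := exists_pow_mul_integralMean_le hp hα hω h1 hρ
  have hρ1 : ENNReal.ofReal ρ < 1 := ENNReal.ofReal_lt_one.2 hρ.2
  refine ⟨A * (2 * (1 - ENNReal.ofReal ρ)⁻¹), ENNReal.mul_ne_top ENNReal.coe_ne_top
    (ENNReal.mul_ne_top (by norm_num) (ENNReal.inv_ne_top.2 (tsub_pos_of_lt hρ1).ne')),
    fun f hf => iSup₂_le fun r hr => ?_⟩
  obtain ⟨m, hm⟩ := exists_mem_Ico_cutRadius hl hgeom hr0 hr1 (cutRadius_zero hw h1 hα)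
    (Ioo_subset_Ico_self hr)
  -- The tail decreases from its value `2 ^ (-m α)` at `r_m`, so the weight is absorbed by the
  -- normalisation `ρ ^ m`.
  have htail : tail ω r ^ β ≤ ρ ^ m := by
    obtain ⟨hcm, hct⟩ := cutRadius_spec h1 hα m hw
    have hle : tail ω r ≤ tail ω (cutRadius ω α m) :=
      (tail_strictAntiOn hw h1).antitoneOn hcm (Ioo_subset_Ico_self hr) hm.1
    rw [hct] at hle
    refine (Real.rpow_le_rpow (tail_pos hw h1 (Ioo_subset_Ico_self hr)).le hle hβ.le).trans ?_
    rw [← Real.rpow_mul zero_le_two, hρdef, ← two_rpow_neg_mul]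
    exact le_of_eq (by congr 1; ring)
  calc _ ≤ ENNReal.ofReal (ρ ^ m) * integralMean p r f := by rw [mul_comm]; gcongr
    _ ≤ _ := hA f hf m r hm
    _ ≤ A * (2 * (1 - ENNReal.ofReal ρ)⁻¹ *
          ⨆ n, ENNReal.ofReal (ρ ^ n) * hardyNorm p (block ω α n f)) := by
        gcongr
        exact iSup_tsum_pow_dist_mul_le _ _ m
    _ = _ := by
        have hsup : blockSup p β ω α f =
            ⨆ n, ENNReal.ofReal (ρ ^ n) * hardyNorm p (block ω α n f) := by
          unfold blockSup
          refine iSup_congr fun n => ?_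
          rw [hρdef, ← two_rpow_neg_mul, mul_assoc (n : ℝ)]
        rw [hsup, mul_assoc, mul_assoc, mul_assoc]

/-- The single radius `r_{n+1}` suffices: the weight there is `2 ^ (-(n + 1) α β)`, and the index
shift costs the factor `2 ^ (α β)`. -/
theorem exists_blockSup_le {p α β : ℝ} (hp : 1 < p) (hα : 0 < α) {ω : ℝ → ℝ}
    (hω : IsRapidlyIncreasing ω ∨ IsRegular ω) (h1 : ∫ r in (0 : ℝ)..1, ω r = 1) :
    ∃ K : ℝ≥0∞, K ≠ ∞ ∧ ∀ f : ℂ → ℂ, DifferentiableOn ℂ f (Metric.ball 0 1) →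
      blockSup p β ω α f ≤ K * mixedSupNorm p (fun r => tail ω r ^ β) f := by
  have hw := isRadialWeight_of_or hω
  have hr1 : ∀ n, cutRadius ω α n < 1 := fun n => (cutRadius_spec h1 hα n hw).1.2
  obtain ⟨l, hl, hgeom⟩ := exists_cutRadius_geometric hω h1 hα
  have hmono := monotone_cutRadius hl hgeom hr1
  obtain ⟨A, hA⟩ := exists_hardyNorm_block_le_integralMean hp hα hω h1
  refine ⟨ENNReal.ofReal ((2 : ℝ) ^ (α * β)) * A,
    ENNReal.mul_ne_top ENNReal.ofReal_ne_top ENNReal.coe_ne_top, fun f hf => iSup_le fun n => ?_⟩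
  obtain ⟨_, hct⟩ := cutRadius_spec h1 hα (n + 1) hw
  set r := cutRadius ω α (n + 1) with hr
  have hrmem : r ∈ Ioo (0 : ℝ) 1 :=
    ⟨(cutRadius_one_pos hw h1 hα).trans_le (hmono (by omega : 1 ≤ n + 1)), hr1 _⟩
  have hexp : (2 : ℝ) ^ (-(n * α * β)) = (2 : ℝ) ^ (α * β) * tail ω r ^ β := by
    rw [hct, ← Real.rpow_mul zero_le_two, ← Real.rpow_add two_pos]
    congr 1
    push_cast
    ring
  calc _ ≤ ENNReal.ofReal ((2 : ℝ) ^ (-(n * α * β))) * (A * integralMean p r f) := by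
        gcongr
        exact hA f hf n r le_rfl hrmem.2
    _ = ENNReal.ofReal ((2 : ℝ) ^ (α * β)) * A *
          (integralMean p r f * ENNReal.ofReal (tail ω r ^ β)) := by
        rw [hexp, ENNReal.ofReal_mul (by positivity)]
        ring
    _ ≤ _ := by
        rw [mixedSupNorm]
        refine mul_le_mul_right ?_ _
        exact le_iSup₂_of_le (f := fun r (_ : r ∈ Ioo (0 : ℝ) 1) =>
          integralMean p r f * ENNReal.ofReal (tail ω r ^ β)) r hrmem le_rfl

/-- Two one-sided estimates with finite constants combine to a two-sided estimate with a single
positive constant. -/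
theorem exists_common_constant {ι : Type*} {P : ι → Prop} {a b : ι → ℝ≥0∞}
    (hab : ∃ K : ℝ≥0∞, K ≠ ∞ ∧ ∀ i, P i → a i ≤ K * b i)
    (hba : ∃ K : ℝ≥0∞, K ≠ ∞ ∧ ∀ i, P i → b i ≤ K * a i) :
    ∃ C : ℝ≥0, 0 < C ∧ ∀ i, P i → (a i < ∞ ↔ b i < ∞) ∧ a i ≤ C * b i ∧ b i ≤ C * a i := by
  obtain ⟨K, hK, h1⟩ := hab
  obtain ⟨L, hL, h2⟩ := hba
  lift K to ℝ≥0 using hK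
  lift L to ℝ≥0 using hL
  have hKC : (K : ℝ≥0∞) ≤ ((K + L + 1 : ℝ≥0) : ℝ≥0∞) := by
    rw [ENNReal.coe_le_coe, add_assoc]; exact le_self_add
  have hLC : (L : ℝ≥0∞) ≤ ((K + L + 1 : ℝ≥0) : ℝ≥0∞) := by
    rw [ENNReal.coe_le_coe, add_comm K L, add_assoc]; exact le_self_add
  refine ⟨K + L + 1, by positivity, fun i hi => ⟨⟨fun h => ?_, fun h => ?_⟩, ?_, ?_⟩⟩
  · exact (h2 i hi).trans_lt (ENNReal.mul_lt_top ENNReal.coe_lt_top h)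
  · exact (h1 i hi).trans_lt (ENNReal.mul_lt_top ENNReal.coe_lt_top h)
  · exact (h1 i hi).trans (by gcongr)
  · exact (h2 i hi).trans (by gcongr)

end MixedNorm

/-! ### Assembly of the two equivalences -/

theorem theorem4 (p α : ℝ) (hp : 1 < p) (hα : 0 < α) (ω : ℝ → ℝ)
    (hω : MixedNorm.IsRapidlyIncreasing ω ∨ MixedNorm.IsRegular ω)
    (hω1 : ∫ r in (0 : ℝ)..1, ω r = 1) :
    (∀ q : ℝ, 0 < q → ∃ C : ℝ≥0, 0 < C ∧
      ∀ f : ℂ → ℂ, DifferentiableOn ℂ f (Metric.ball 0 1) →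
        (f ∈ MixedNorm.mixedSpace p q ω ↔ MixedNorm.blockSum p q ω α f < ∞) ∧
        MixedNorm.mixedNorm p q ω f ≤ C * MixedNorm.blockSum p q ω α f ^ (1 / q) ∧
        MixedNorm.blockSum p q ω α f ^ (1 / q) ≤ C * MixedNorm.mixedNorm p q ω f) ∧
    (∀ β : ℝ, 0 < β → ∃ C : ℝ≥0, 0 < C ∧
      ∀ f : ℂ → ℂ, DifferentiableOn ℂ f (Metric.ball 0 1) →
        (f ∈ MixedNorm.mixedSupSpace p (fun r => MixedNorm.tail ω r ^ β) ↔
          MixedNorm.blockSup p β ω α f < ∞) ∧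
        MixedNorm.mixedSupNorm p (fun r => MixedNorm.tail ω r ^ β) f ≤
          C * MixedNorm.blockSup p β ω α f ∧
        MixedNorm.blockSup p β ω α f ≤
          C * MixedNorm.mixedSupNorm p (fun r => MixedNorm.tail ω r ^ β) f) := by
  constructor
  · intro q hq
    obtain ⟨C, hC, h⟩ := MixedNorm.exists_common_constant
      (MixedNorm.exists_mixedNorm_le hp hq hα hω hω1)
      (MixedNorm.exists_blockSum_le hp hq hα hω hω1)
    refine ⟨C, hC, fun f hf => ⟨?_, (h f hf).2⟩⟩
    have h1 := (h f hf).1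
    rw [ENNReal.rpow_lt_top_iff_of_pos (by positivity)] at h1
    exact ⟨fun hf' => h1.1 hf'.2, fun hb => ⟨hf, h1.2 hb⟩⟩
  · intro β hβ
    obtain ⟨C, hC, h⟩ := MixedNorm.exists_common_constant
      (MixedNorm.exists_mixedSupNorm_le hp hβ hα hω hω1)
      (MixedNorm.exists_blockSup_le (β := β) hp hα hω hω1)
    exact ⟨C, hC, fun f hf => ⟨⟨fun hf' => (h f hf).1.1 hf'.2,
      fun hb => ⟨hf, (h f hf).1.2 hb⟩⟩, (h f hf).2⟩⟩
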